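/- **Theorem (Haagerup, Cowling--Haagerup).** Let $\Gamma$ be a discrete group. The following are equivalent: 1. the group $\Gamma$ is weakly amenable; 2. the reduced group $C^*$-algebra $C_\lambda^*(\Gamma)$ has the completely bounded approximation property (CBAP); 3. the group von Neumann algebra $L\Gamma$ has the weak*-completely bounded approximation property (w*-CBAP). Moreover, $$\boldsymbol\Lambda(\Gamma)=\boldsymbol\Lambda_{\mathrm{cb}}(C_\lambda^*(\Gamma))=\boldsymbol\Lambda_{\mathrm{w^*cb}}(L\Gamma)$$ as elements of $[1,\infty]$. Here $\lambda$ is the left regular representation of $\Gamma$ on $\ell^2(\Gamma)$, extended linearly to $\mathbb{C}[\Gamma]$; $C_\lambda^*(\Gamma)$ and $L\Gamma$ are the closures of $\lambda(\mathbb{C}[\Gamma])$ in $\mathbf{B}(\ell^2(\Gamma))$ for the operator norm and for the strong operator topology. The completely bounded norm of a linear map $u$ is $\|u\|_{\mathrm{cb}}=\sup_n\|u_n\|$, where $u_n$ applies $u$ to each entry of an $n\times n$ matrix. * The Fourier--Stieltjes algebra $B(\Gamma)$ consists of the coefficients $s\mapsto\langle\pi(s)\xi,\eta\rangle$ of unitary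 representations $\pi$ of $\Gamma$, normed by the infimum of $\|\xi\|\|\eta\|$ over all such expressions; the Fourier algebra $A(\Gamma)$ is the closed linear span in $B(\Gamma)$ of the coefficients of $\lambda$. A function $\varphi:\Gamma\to\mathbb{C}$ with $\varphi A(\Gamma)\subseteq A(\Gamma)$ defines a weak*-continuous linear map $M_\varphi:L\Gamma\to L\Gamma$, the dual of $a\mapsto\varphi a$ under $A(\Gamma)^*=L\Gamma$, determined by $M_\varphi\lambda(s)=\varphi(s)\lambda(s)$ for all $s\in\Gamma$; put $\|\varphi\|_{M_0A(\Gamma)}=\|M_\varphi\|_{\mathrm{cb}}\in[0,\infty]$. The group $\Gamma$ is weakly amenable if, for some $C\ge1$, there is a net $(a_i)$ in $A(\Gamma)$ with $\|a_i\|_{M_0A(\Gamma)}\le C$ for all $i$ that converges to $1$ uniformly on finite subsets of $\Gamma$; $\boldsymbol\Lambda(\Gamma)$ is the infimum of all such $C\geq 1$. * A $C^*$-algebra $\mathcal{A}$ has the CBAP if, for some $C\ge1$, there is a net of finite rank linear maps $T_i:\mathcal{A}\to\mathcal{A}$ with $\|T_i\|_{\mathrm{cb}}\le C$ for all $i$ and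 $\|T_ix-x\|\to0$ for every $x\in\mathcal{A}$; $\boldsymbol\Lambda_{\mathrm{cb}}(\mathcal{A})$ is the infimum of all such $C\geq 1$. * A von Neumann algebra $\mathcal{M}$ has the w*-CBAP if, for some $C\ge1$, there is a net of finite rank, weak*-weak*-continuous linear maps $T_i:\mathcal{M}\to\mathcal{M}$ with $\|T_i\|_{\mathrm{cb}}\le C$ for all $i$ and $\langle T_ix,y\rangle\to\langle x,y\rangle$ for every $x\in\mathcal{M}$ and every $y$ in the predual $\mathcal{M}_*$; $\boldsymbol\Lambda_{\mathrm{w^*cb}}(\mathcal{M})$ is the infimum of all such $C\geq 1$. Each of these constants is $\infty$ when the corresponding property fails. -/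

import Mathlib

open Filter Topology
open scoped ENNReal NNReal

namespace CowlingHaagerup

universe u v w

noncomputable section

/-! ### Matrices of operators and completely bounded maps -/

section CompletelyBounded

variable {H : Type u} [NormedAddCommGroup H] [InnerProductSpace ℂ H]
variable {K : Type v} [NormedAddCommGroup K] [InnerProductSpace ℂ K]

/-- The identification `M_n(B(H)) = B(Hⁿ)`, where `Hⁿ` is the Hilbert space direct sum of `n` copies
of `H`: the operator `ξ ↦ (∑ j, x i j (ξ j))_i`. -/
def blockOp {n : Type w} [Fintype n] (x : Matrix n n (H →L[ℂ] H)) :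
    PiLp 2 (fun _ : n => H) →L[ℂ] PiLp 2 (fun _ : n => H) :=
  (PiLp.continuousLinearEquiv 2 ℂ (fun _ : n => H)).symm.toContinuousLinearMap ∘L
    ContinuousLinearMap.pi (fun i => ∑ j, x i j ∘L PiLp.proj 2 (fun _ : n => H) j)

@[simp]
theorem blockOp_apply {n : Type w} [Fintype n] (x : Matrix n n (H →L[ℂ] H))
    (ξ : PiLp 2 (fun _ : n => H)) (i : n) : blockOp x ξ i = ∑ j, x i j (ξ j) := by
  simp [blockOp]

/-- The completely bounded norm `‖u‖_cb = sup_n ‖u_n‖ ∈ [0, ∞]` of a linear map `u : V → W` between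
linear spaces `V ⊆ B(H)` and `W ⊆ B(K)` of operators, where `u_n : M_n(V) → M_n(W)` is `u` applied
entrywise, `M_n(V) ⊆ B(Hⁿ)` and `M_n(W) ⊆ B(Kⁿ)`, and
`‖u_n‖` is the supremum of `‖u_n(x)‖` over the unit ball of `M_n(V)`. -/
def cbNorm {V : Submodule ℂ (H →L[ℂ] H)} {W : Submodule ℂ (K →L[ℂ] K)} (u : V →ₗ[ℂ] W) : ℝ≥0∞ :=
  ⨆ (n : ℕ) (x : Matrix (Fin n) (Fin n) V)
    (_ : ‖blockOp (fun i j => (x i j : H →L[ℂ] H))‖ ≤ 1),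
    ‖blockOp (fun i j => (u (x i j) : K →L[ℂ] K))‖ₑ

end CompletelyBounded

/-! ### The completely bounded approximation property -/

section CBAP

variable {H : Type u} [NormedAddCommGroup H] [InnerProductSpace ℂ H]

variable (H) in
/-- The pairs of square-summable sequences of vectors of `H`. Such a pair `(ξ, η)` represents the
trace-class operator `y = ∑ n, ⟨·, η n⟩ ξ n`, and every trace-class operator is of this form. -/
structure TracePair where
  /-- the vectors `ξ n` -/
  ξ : ℕ → H
  /-- the vectors `η n` -/
  η : ℕ → H
  summable_ξ : Summable fun n => ‖ξ n‖ ^ 2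
  summable_η : Summable fun n => ‖η n‖ ^ 2

/-- The duality `⟨x, y⟩ = Tr(x y) = ∑ n, ⟨x ξ n, η n⟩` between bounded operators `x` and
trace-class operators `y = ∑ n, ⟨·, η n⟩ ξ n`. -/
def TracePair.pairing (y : TracePair H) (x : H →L[ℂ] H) : ℂ :=
  ∑' n, inner ℂ (y.η n) (x (y.ξ n))

/-- The series defining the duality converges absolutely. -/
theorem TracePair.summable_norm (y : TracePair H) (x : H →L[ℂ] H) :
    Summable fun n => ‖inner ℂ (y.η n) (x (y.ξ n))‖ := by
  refine Summable.of_nonneg_of_le (fun _ => norm_nonneg _) (fun n => ?_)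
    ((y.summable_η.add y.summable_ξ).mul_left ‖x‖)
  calc ‖inner ℂ (y.η n) (x (y.ξ n))‖ ≤ ‖y.η n‖ * (‖x‖ * ‖y.ξ n‖) :=
        (norm_inner_le_norm _ _).trans
          (mul_le_mul_of_nonneg_left (x.le_opNorm _) (norm_nonneg _))
    _ = ‖x‖ * (‖y.η n‖ * ‖y.ξ n‖) := by ring
    _ ≤ ‖x‖ * (‖y.η n‖ ^ 2 + ‖y.ξ n‖ ^ 2) := by
        refine mul_le_mul_of_nonneg_left ?_ (norm_nonneg _)
        nlinarith [sq_nonneg (‖y.η n‖ - ‖y.ξ n‖), sq_nonneg ‖y.η n‖, sq_nonneg ‖y.ξ n‖]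

variable [CompleteSpace H]

/-- The condition in the definition of the CBAP of a C⋆-algebra `A ⊆ B(H)`, for a given constant
`C`: there is a net `(T_i)` of finite rank linear maps `A → A` with `‖T_i‖_cb ≤ C` and
`‖T_i x - x‖ → 0` for all `x ∈ A`. -/
def HasCBAPWith (A : NonUnitalStarSubalgebra ℂ (H →L[ℂ] H)) (C : ℝ≥0) : Prop :=
  ∃ (ι : Type u) (_ : Preorder ι) (_ : IsDirectedOrder ι) (_ : Nonempty ι)
    (T : ι → (A.toSubmodule →ₗ[ℂ] A.toSubmodule)),
    (∀ i, FiniteDimensional ℂ (LinearMap.range (T i))) ∧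
    (∀ i, cbNorm (T i) ≤ C) ∧
    ∀ x, Tendsto (fun i => ‖T i x - x‖) atTop (𝓝 0)

/-- The completely bounded approximation property (CBAP). -/
def HasCBAP (A : NonUnitalStarSubalgebra ℂ (H →L[ℂ] H)) : Prop :=
  ∃ C : ℝ≥0, 1 ≤ C ∧ HasCBAPWith A C

/-- The constant `Λ_cb(A) ∈ [1, ∞]`; it is `∞` when `A` does not have the CBAP. -/
def cbapConstant (A : NonUnitalStarSubalgebra ℂ (H →L[ℂ] H)) : ℝ≥0∞ :=
  ⨅ (C : ℝ≥0) (_ : 1 ≤ C) (_ : HasCBAPWith A C), (C : ℝ≥0∞)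

/-- The underlying linear space of a von Neumann algebra `M ⊆ B(H)`. -/
abbrev toSubmodule (M : VonNeumannAlgebra H) : Submodule ℂ (H →L[ℂ] H) :=
  M.toStarSubalgebra.toSubalgebra.toSubmodule

/-- The weak⋆-topology of a von Neumann algebra `M ⊆ B(H)`: the coarsest topology for which
`x ↦ Tr(x y)` is continuous on `M` for every trace-class operator `y`. -/
@[reducible] def weakStarTopology (M : VonNeumannAlgebra H) : TopologicalSpace (toSubmodule M) :=
  ⨅ y : TracePair H,
    TopologicalSpace.induced (fun x : toSubmodule M => y.pairing (x : H →L[ℂ] H)) inferInstance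

/-- Weak⋆-weak⋆-continuity of a linear map `M → M`. -/
def IsWeakStarContinuous (M : VonNeumannAlgebra H) (T : toSubmodule M →ₗ[ℂ] toSubmodule M) : Prop :=
  @Continuous _ _ (weakStarTopology M) (weakStarTopology M) T

/-- The condition in the definition of the w⋆-CBAP of a von Neumann algebra `M ⊆ B(H)`, for a given
constant `C`: there is a net `(T_i)` of finite rank, weak⋆-weak⋆-continuous linear maps `M → M` with
`‖T_i‖_cb ≤ C` and `⟨T_i x, y⟩ → ⟨x, y⟩` for all `x ∈ M` and all `y` in the predual. -/
def HasWStarCBAPWith (M : VonNeumannAlgebra H) (C : ℝ≥0) : Prop :=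
  ∃ (ι : Type u) (_ : Preorder ι) (_ : IsDirectedOrder ι) (_ : Nonempty ι)
    (T : ι → (toSubmodule M →ₗ[ℂ] toSubmodule M)),
    (∀ i, FiniteDimensional ℂ (LinearMap.range (T i))) ∧
    (∀ i, IsWeakStarContinuous M (T i)) ∧
    (∀ i, cbNorm (T i) ≤ C) ∧
    ∀ (x : toSubmodule M) (y : TracePair H),
      Tendsto (fun i => y.pairing (T i x : H →L[ℂ] H)) atTop (𝓝 (y.pairing (x : H →L[ℂ] H)))

/-- The weak⋆-completely bounded approximation property (w⋆-CBAP). -/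
def HasWStarCBAP (M : VonNeumannAlgebra H) : Prop :=
  ∃ C : ℝ≥0, 1 ≤ C ∧ HasWStarCBAPWith M C

/-- The constant `Λ_{w⋆cb}(M) ∈ [1, ∞]`; it is `∞` when `M` does not have the w⋆-CBAP. -/
def wStarCBAPConstant (M : VonNeumannAlgebra H) : ℝ≥0∞ :=
  ⨅ (C : ℝ≥0) (_ : 1 ≤ C) (_ : HasWStarCBAPWith M C), (C : ℝ≥0∞)

end CBAP

/-! ### The von Neumann algebra generated by a unital ⋆-algebra of operators -/

section Bicommutant

variable {H : Type u} [NormedAddCommGroup H] [InnerProductSpace ℂ H]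

/-- The closure of a set of operators in the strong operator topology. -/
def sotClosure (S : Set (H →L[ℂ] H)) : Set (H →L[ℂ] H) :=
  ContinuousLinearMap.toPointwiseConvergenceCLM ℂ (RingHom.id ℂ) H H ⁻¹'
    closure (ContinuousLinearMap.toPointwiseConvergenceCLM ℂ (RingHom.id ℂ) H H '' S)

theorem mem_sotClosure_iff {S : Set (H →L[ℂ] H)} {x : H →L[ℂ] H} :
    x ∈ sotClosure S ↔
      ∀ (F : Finset H) (ε : ℝ), 0 < ε → ∃ a ∈ S, ∀ ξ ∈ F, ‖a ξ - x ξ‖ < ε := by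
  unfold sotClosure
  rw [Set.mem_preimage, mem_closure_iff_nhds_basis
    (PointwiseConvergenceCLM.withSeminorms (σ := RingHom.id ℂ) (E := H) (F := H)).hasBasis_ball]
  constructor
  · intro h F ε hε
    obtain ⟨_, ⟨a, ha, rfl⟩, hb⟩ := h (F, ε) hε
    refine ⟨a, ha, fun ξ hξ => ?_⟩
    rw [Seminorm.mem_ball] at hb
    exact (Seminorm.le_finset_sup_apply (p := PointwiseConvergenceCLM.seminormFamily
      (RingHom.id ℂ) H H) hξ).trans_lt hb
  · rintro h ⟨F, ε⟩ hε
    obtain ⟨a, ha, hb⟩ := h F ε hε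
    refine ⟨_, ⟨a, ha, rfl⟩, ?_⟩
    rw [Seminorm.mem_ball]
    exact Seminorm.finset_sup_apply_lt hε hb


theorem subset_sotClosure (S : Set (H →L[ℂ] H)) : S ⊆ sotClosure S :=
  fun a ha => mem_sotClosure_iff.2 fun _ _ hε => ⟨a, ha, fun _ _ => by simpa using hε⟩

/-- The strong operator closure of a set of operators is contained in its bicommutant. -/
theorem sotClosure_subset_bicommutant (A : Set (H →L[ℂ] H)) :
    sotClosure A ⊆ Set.centralizer (Set.centralizer A) := by
  intro x hx y hy
  ext ξ
  change y (x ξ) = x (y ξ)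
  rw [← sub_eq_zero, ← norm_eq_zero]
  refine le_antisymm (le_of_forall_pos_le_add fun ε hε => ?_) (norm_nonneg _)
  have hδ : 0 < ε / (‖y‖ + 1) := by positivity
  classical
  obtain ⟨a, ha, hax⟩ := mem_sotClosure_iff.1 hx {ξ, y ξ} _ hδ
  have h1 := hax ξ (by simp)
  have h2 := hax (y ξ) (by simp)
  have hc : a (y ξ) = y (a ξ) := congrArg (fun T : H →L[ℂ] H => T ξ) (hy a ha)
  have e : y (x ξ) - x (y ξ) = (a (y ξ) - x (y ξ)) - y (a ξ - x ξ) := by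
    rw [map_sub, hc]; abel
  rw [e]
  calc ‖(a (y ξ) - x (y ξ)) - y (a ξ - x ξ)‖
      ≤ ‖a (y ξ) - x (y ξ)‖ + ‖y‖ * ‖a ξ - x ξ‖ :=
        (norm_sub_le _ _).trans (add_le_add_right (y.le_opNorm _) _)
    _ ≤ ε / (‖y‖ + 1) + ‖y‖ * (ε / (‖y‖ + 1)) :=
        add_le_add h2.le (mul_le_mul_of_nonneg_left h1.le (norm_nonneg _))
    _ = 0 + ε := by field_simp; ring

/-- The diagonal operator `ξ ↦ (x (ξ i))_i` on `Hⁿ`. -/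
def diagOp (n : Type w) [Fintype n] (x : H →L[ℂ] H) :
    PiLp 2 (fun _ : n => H) →L[ℂ] PiLp 2 (fun _ : n => H) :=
  (PiLp.continuousLinearEquiv 2 ℂ (fun _ : n => H)).symm.toContinuousLinearMap ∘L
    ContinuousLinearMap.pi (fun i => x ∘L PiLp.proj 2 (fun _ : n => H) i)

@[simp]
theorem diagOp_apply {n : Type w} [Fintype n] (x : H →L[ℂ] H)
    (ξ : PiLp 2 (fun _ : n => H)) (i : n) : diagOp n x ξ i = x (ξ i) := by
  simp [diagOp]

variable [CompleteSpace H]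

theorem inner_diagOp_star {n : Type w} [Fintype n] (x : H →L[ℂ] H)
    (ξ η : PiLp 2 (fun _ : n => H)) :
    inner ℂ (diagOp n (star x) ξ) η = inner ℂ ξ (diagOp n x η) := by
  simp only [PiLp.inner_apply, diagOp_apply, ContinuousLinearMap.star_eq_adjoint,
    ContinuousLinearMap.adjoint_inner_left]

/-- Density theorem: the bicommutant of a unital ⋆-algebra of operators is contained in its
strong operator closure. -/
theorem bicommutant_subset_sotClosure (A : StarSubalgebra ℂ (H →L[ℂ] H)) :
    Set.centralizer (Set.centralizer (A : Set (H →L[ℂ] H))) ⊆ sotClosure (A : Set (H →L[ℂ] H)) := by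
  classical
  intro x hx
  rw [mem_sotClosure_iff]
  intro F ε hε
  let v : PiLp 2 (fun _ : F => H) := WithLp.toLp 2 (fun i => (i : H))
  let K₀ : Submodule ℂ (PiLp 2 (fun _ : F => H)) :=
    { carrier := {w | ∃ a ∈ A, w = diagOp F a v}
      add_mem' := by
        rintro _ _ ⟨a, ha, rfl⟩ ⟨b, hb, rfl⟩
        exact ⟨a + b, add_mem ha hb, by ext i; simp⟩
      zero_mem' := ⟨0, zero_mem A, by ext i; simp⟩
      smul_mem' := by
        rintro c _ ⟨a, ha, rfl⟩
        exact ⟨c • a, A.smul_mem ha c, by ext i; simp⟩ }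
  let K := K₀.topologicalClosure
  have : CompleteSpace K := K₀.isClosed_topologicalClosure.completeSpace_coe
  have hvK : v ∈ K := K₀.le_topologicalClosure ⟨1, one_mem A, by ext i; simp⟩
  have hK : ∀ a ∈ A, ∀ w ∈ K, diagOp F a w ∈ K := by
    intro a ha w hw
    have hmap : Set.MapsTo (diagOp F a) (K₀ : Set (PiLp 2 (fun _ : F => H))) K₀ := by
      rintro _ ⟨b, hb, rfl⟩
      exact ⟨a * b, mul_mem ha hb, by ext i; simp⟩
    exact hmap.closure (diagOp F a).continuous hw
  have hP : ∀ a ∈ A, ∀ w, K.starProjection (diagOp F a w) = diagOp F a (K.starProjection w) := by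
    intro a ha w
    refine Submodule.eq_starProjection_of_mem_of_inner_eq_zero
      (hK a ha _ (Submodule.starProjection_apply_mem K w)) fun u hu => ?_
    have h := inner_diagOp_star (star a) (w - K.starProjection w) u
    rw [star_star] at h
    rw [← map_sub, h]
    exact Submodule.starProjection_inner_eq_zero w _ (hK (star a) (star_mem ha) u hu)
  let E : F → F → (H →L[ℂ] H) := fun i j =>
    PiLp.proj 2 (fun _ : F => H) i ∘L K.starProjection ∘L
      (PiLp.continuousLinearEquiv 2 ℂ (fun _ : F => H)).symm.toContinuousLinearMap ∘L
        ContinuousLinearMap.single ℂ (fun _ : F => H) j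
  have hsum : ∀ w : PiLp 2 (fun _ : F => H), ∀ i, K.starProjection w i = ∑ j, E i j (w j) := by
    intro w i
    have hw : w = ∑ j, (PiLp.continuousLinearEquiv 2 ℂ (fun _ : F => H)).symm
        (ContinuousLinearMap.single ℂ (fun _ : F => H) j (w j)) := by
      rw [← map_sum]
      ext k
      simp [Finset.sum_apply, Pi.single_apply]
    conv_lhs => rw [hw, map_sum]
    simp [E]
  have hE : ∀ i j, E i j ∈ Set.centralizer (A : Set (H →L[ℂ] H)) := by
    intro i j a ha
    ext ξ
    have h := congrArg (fun w : PiLp 2 (fun _ : F => H) => w i)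
      (hP a ha ((PiLp.continuousLinearEquiv 2 ℂ (fun _ : F => H)).symm
        (ContinuousLinearMap.single ℂ (fun _ : F => H) j ξ)))
    have h' : diagOp F a ((PiLp.continuousLinearEquiv 2 ℂ (fun _ : F => H)).symm
        (ContinuousLinearMap.single ℂ (fun _ : F => H) j ξ)) =
        (PiLp.continuousLinearEquiv 2 ℂ (fun _ : F => H)).symm
        (ContinuousLinearMap.single ℂ (fun _ : F => H) j (a ξ)) := by
      ext k
      by_cases hkj : k = j
      · subst hkj; simp
      · simp [hkj]
    rw [h'] at h
    simpa [E] using h.symm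
  have hmem : diagOp F x v ∈ K := by
    rw [← Submodule.starProjection_eq_self_iff]
    have hv : K.starProjection v = v := Submodule.starProjection_eq_self_iff.2 hvK
    ext i
    rw [hsum, diagOp_apply]
    conv_rhs => rw [← hv, hsum, map_sum]
    refine Finset.sum_congr rfl fun j _ => ?_
    rw [diagOp_apply]
    exact congrArg (fun T : H →L[ℂ] H => T (v j)) (hx (E i j) (hE i j))
  obtain ⟨_, ⟨a, ha, rfl⟩, hd⟩ := Metric.mem_closure_iff.1 hmem ε hε
  refine ⟨a, ha, fun ξ hξ => ?_⟩
  rw [dist_eq_norm] at hd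
  have h1 := PiLp.norm_apply_le (diagOp F x v - diagOp F a v) ⟨ξ, hξ⟩
  have h2 : (diagOp F x v - diagOp F a v) ⟨ξ, hξ⟩ = x ξ - a ξ := by simp [v]
  rw [h2, norm_sub_rev] at h1
  exact h1.trans_lt hd

/-- The von Neumann algebra generated by a unital ⋆-algebra `A` of operators: the closure of `A`
in the strong operator topology. -/
def sotClosureVonNeumann (A : StarSubalgebra ℂ (H →L[ℂ] H)) : VonNeumannAlgebra H :=
  have h : Set.centralizer (Set.centralizer (A : Set (H →L[ℂ] H))) =
      sotClosure (A : Set (H →L[ℂ] H)) :=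
    (bicommutant_subset_sotClosure A).antisymm (sotClosure_subset_bicommutant _)
  have hs : ((StarSubalgebra.centralizer ℂ
      (StarSubalgebra.centralizer ℂ (A : Set (H →L[ℂ] H)) : Set (H →L[ℂ] H)) :
        StarSubalgebra ℂ (H →L[ℂ] H)) : Set (H →L[ℂ] H)) = sotClosure (A : Set (H →L[ℂ] H)) := by
    rw [StarSubalgebra.coe_centralizer_centralizer, StarMemClass.star_coe_eq, Set.union_self, h]
  { carrier := sotClosure (A : Set (H →L[ℂ] H))
    mul_mem' := by rw [← hs]; exact mul_mem
    one_mem' := by rw [← hs]; exact one_mem _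
    add_mem' := by rw [← hs]; exact add_mem
    zero_mem' := by rw [← hs]; exact zero_mem _
    algebraMap_mem' := by rw [← hs]; exact algebraMap_mem _
    star_mem' := by rw [← hs]; exact star_mem
    centralizer_centralizer' := by
      rw [← h, Set.centralizer_centralizer_centralizer] }

end Bicommutant
/-! ### The left regular representation and the operator algebras of a discrete group -/

section Group

/-- The Hilbert space `ℓ²(Γ)`. -/
abbrev EllTwo (Γ : Type u) : Type u := lp (fun _ : Γ => ℂ) 2

variable (Γ : Type u) [Group Γ]

variable {Γ} in
/-- Left translation `f ↦ (t ↦ f (s⁻¹ t))` on `ℓ²(Γ)`. -/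
def leftTranslation (s : Γ) : EllTwo Γ ≃ₗᵢ[ℂ] EllTwo Γ where
  toFun f := ⟨fun t => f (s⁻¹ * t), memℓp_gen
    (((lp.memℓp f).summable (by simp)).comp_injective (mul_right_injective s⁻¹))⟩
  invFun f := ⟨fun t => f (s * t), memℓp_gen
    (((lp.memℓp f).summable (by simp)).comp_injective (mul_right_injective s))⟩
  map_add' f g := by ext t; rfl
  map_smul' c f := by ext t; rfl
  left_inv f := by ext t; simp
  right_inv f := by ext t; simp
  norm_map' f := by
    rw [lp.norm_eq_tsum_rpow (by simp), lp.norm_eq_tsum_rpow (by simp)]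
    congr 1
    exact (Equiv.mulLeft s⁻¹).tsum_eq (fun t => ‖f t‖ ^ (2 : ℝ≥0∞).toReal)

/-- The left regular representation `λ` of `Γ` by unitary operators on `ℓ²(Γ)`. -/
def leftRegular : Γ →* unitary (EllTwo Γ →L[ℂ] EllTwo Γ) :=
  (Unitary.linearIsometryEquiv (𝕜 := ℂ) (H := EllTwo Γ)).symm.toMonoidHom.comp
    { toFun := leftTranslation
      map_one' := by ext f t; simp [leftTranslation]
      map_mul' := fun s r => by ext f t; simp [leftTranslation, mul_assoc] }

@[simp]
theorem leftRegular_apply (s : Γ) (f : EllTwo Γ) (t : Γ) :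
    (leftRegular Γ s : EllTwo Γ →L[ℂ] EllTwo Γ) f t = f (s⁻¹ * t) := rfl

/-- The extension of `λ` to the group algebra: `λ(f) = ∑ s, f(s) λ(s)` for `f ∈ ℂ[Γ]`. -/
def leftRegularAlg : MonoidAlgebra ℂ Γ →ₐ[ℂ] (EllTwo Γ →L[ℂ] EllTwo Γ) :=
  MonoidAlgebra.lift ℂ (EllTwo Γ →L[ℂ] EllTwo Γ) Γ ((unitary _).subtype.comp (leftRegular Γ))

theorem leftRegularAlg_single (s : Γ) (c : ℂ) :
    leftRegularAlg Γ (MonoidAlgebra.single s c) =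
      c • (leftRegular Γ s : EllTwo Γ →L[ℂ] EllTwo Γ) := by
  simp [leftRegularAlg]

/-- The unital ⋆-algebra `λ(ℂ[Γ])` of operators on `ℓ²(Γ)`. -/
def groupAlgebraImage : StarSubalgebra ℂ (EllTwo Γ →L[ℂ] EllTwo Γ) where
  toSubalgebra := (leftRegularAlg Γ).range
  star_mem' := by
    rintro _ ⟨f, rfl⟩
    change star (leftRegularAlg Γ f) ∈ (leftRegularAlg Γ).range
    induction f using MonoidAlgebra.induction_linear with
    | zero => simp
    | add f g hf hg => rw [map_add, star_add]; exact add_mem hf hg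
    | single s c =>
      refine ⟨MonoidAlgebra.single s⁻¹ (star c), ?_⟩
      change leftRegularAlg Γ _ = _
      rw [leftRegularAlg_single, leftRegularAlg_single, star_smul, map_inv]
      rfl

/-- The reduced group C⋆-algebra `C⋆_λ(Γ)`: the norm closure of `λ(ℂ[Γ])` in `B(ℓ²(Γ))`. -/
def reducedGroupCStarAlgebra : NonUnitalStarSubalgebra ℂ (EllTwo Γ →L[ℂ] EllTwo Γ) :=
  (groupAlgebraImage Γ).topologicalClosure.toNonUnitalStarSubalgebra

/-- The group von Neumann algebra `LΓ`: the strong operator closure of `λ(ℂ[Γ])` in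
`B(ℓ²(Γ))`. -/
def groupVonNeumannAlgebra : VonNeumannAlgebra (EllTwo Γ) :=
  sotClosureVonNeumann (groupAlgebraImage Γ)

theorem leftRegular_mem_groupAlgebraImage (s : Γ) :
    (leftRegular Γ s : EllTwo Γ →L[ℂ] EllTwo Γ) ∈ groupAlgebraImage Γ :=
  ⟨MonoidAlgebra.single s 1, (leftRegularAlg_single Γ s 1).trans (one_smul ℂ _)⟩

theorem leftRegular_mem_groupVonNeumannAlgebra (s : Γ) :
    (leftRegular Γ s : EllTwo Γ →L[ℂ] EllTwo Γ) ∈ toSubmodule (groupVonNeumannAlgebra Γ) :=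
  subset_sotClosure _ (leftRegular_mem_groupAlgebraImage Γ s)

/-- The unitary `λ(s)` as an element of `LΓ`. -/
def leftRegularVN (s : Γ) : toSubmodule (groupVonNeumannAlgebra Γ) :=
  ⟨leftRegular Γ s, leftRegular_mem_groupVonNeumannAlgebra Γ s⟩

/-! ### The Fourier algebra and its completely bounded multipliers -/

variable {Γ}

/-- The Fourier–Stieltjes norm: the infimum of `‖ξ‖ ‖η‖` over all the ways of writing
`φ(s) = ⟨π(s) ξ, η⟩` as a coefficient of a unitary representation `π` of `Γ`; it is `∞` when `φ` is
not such a coefficient, that is, when `φ` is not in the Fourier–Stieltjes algebra `B(Γ)`. -/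
def fourierStieltjesNorm (φ : Γ → ℂ) : ℝ≥0∞ :=
  sInf {r | ∃ (H : Type u) (_ : NormedAddCommGroup H) (_ : InnerProductSpace ℂ H)
    (_ : CompleteSpace H) (π : Γ →* unitary (H →L[ℂ] H)) (ξ η : H),
    (∀ s, φ s = inner ℂ η ((π s : H →L[ℂ] H) ξ)) ∧ r = ‖ξ‖ₑ * ‖η‖ₑ}

variable (Γ) in
/-- The Fourier algebra `A(Γ)`: the closed linear span, in the Fourier–Stieltjes algebra, of the
coefficients `s ↦ ⟨λ(s) f, g⟩` of the left regular representation. -/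
def fourierAlgebra : Set (Γ → ℂ) :=
  {a | ∀ ε : ℝ≥0∞, 0 < ε →
    ∃ b ∈ Submodule.span ℂ {c : Γ → ℂ | ∃ f g : EllTwo Γ,
        ∀ s, c s = inner ℂ g ((leftRegular Γ s : EllTwo Γ →L[ℂ] EllTwo Γ) f)},
      fourierStieltjesNorm (a - b) < ε}

/-- `φ` is a multiplier of `A(Γ)`, i.e. `φ ∈ MA(Γ)`. -/
def IsMultiplier (φ : Γ → ℂ) : Prop :=
  ∀ a ∈ fourierAlgebra Γ, φ * a ∈ fourierAlgebra Γ

/-- `M` is the map `M_φ : LΓ → LΓ` associated with a multiplier `φ ∈ MA(Γ)`, that is, the dual map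
of `a ↦ φ a` for the duality `A(Γ)⋆ = LΓ` in which `⟨λ(s), a⟩ = a(s)`: it is the weak⋆-continuous
linear map with `M_φ λ(s) = φ(s) λ(s)` for all `s ∈ Γ`. It is unique since the linear span of the
`λ(s)` is weak⋆-dense. -/
def IsMultiplierMap (φ : Γ → ℂ)
    (M : toSubmodule (groupVonNeumannAlgebra Γ) →ₗ[ℂ] toSubmodule (groupVonNeumannAlgebra Γ)) :
    Prop :=
  IsWeakStarContinuous (groupVonNeumannAlgebra Γ) M ∧
    ∀ s, M (leftRegularVN Γ s) = φ s • leftRegularVN Γ s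

/-- The norm `‖φ‖_{M₀A(Γ)} = ‖M_φ‖_cb` of a completely bounded multiplier; it is `∞` when `φ` is not
a completely bounded multiplier of `A(Γ)`. -/
def cbMultiplierNorm (φ : Γ → ℂ) : ℝ≥0∞ :=
  ⨅ (_ : IsMultiplier φ)
    (M : toSubmodule (groupVonNeumannAlgebra Γ) →ₗ[ℂ] toSubmodule (groupVonNeumannAlgebra Γ))
    (_ : IsMultiplierMap φ M), cbNorm M

/-! ### Weak amenability -/

variable (Γ)

/-- The condition in the definition of weak amenability for a given constant `C`: there is a net
`(a_i)` in `A(Γ)` with `‖a_i‖_{M₀A(Γ)} ≤ C` that converges to `1` uniformly on the compact, i.e.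
finite, subsets of the discrete group `Γ`. -/
def IsWeaklyAmenableWith (C : ℝ≥0) : Prop :=
  ∃ (ι : Type u) (_ : Preorder ι) (_ : IsDirectedOrder ι) (_ : Nonempty ι) (a : ι → Γ → ℂ),
    (∀ i, a i ∈ fourierAlgebra Γ) ∧
    (∀ i, cbMultiplierNorm (a i) ≤ C) ∧
    ∀ K : Set Γ, K.Finite → TendstoUniformlyOn a 1 atTop K

/-- Weak amenability of a discrete group. -/
def IsWeaklyAmenable : Prop :=
  ∃ C : ℝ≥0, 1 ≤ C ∧ IsWeaklyAmenableWith Γ C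

/-- The Cowling–Haagerup constant `Λ(Γ) ∈ [1, ∞]`; it is `∞` when `Γ` is not weakly amenable. -/
def cowlingHaagerupConstant : ℝ≥0∞ :=
  ⨅ (C : ℝ≥0) (_ : 1 ≤ C) (_ : IsWeaklyAmenableWith Γ C), (C : ℝ≥0∞)

end Group

end

end CowlingHaagerup

/-! For each constant c ≥ 1, weak amenability, the CBAP and the w⋆-CBAP with constant c are all
equivalent to one statement about functions, `HasSchurApproximation Γ c`: the function 1 is a
pointwise limit of finitely supported φ for which entrywise multiplication by the kernel φ(s t⁻¹)
has norm at most c on finite scalar matrices. As this holds for each c separately, the three infima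
agree.

From maps to functions: attach to T the symbol φ_T(s) = ⟨T(λ(s)) δ_1, δ_s⟩. The operator matrix (X i
j • λ(g_i g_j⁻¹)) is X ⊗ 1 conjugated by the diagonal unitary with entries λ(g_i), so its norm is at
most ‖X‖. Apply T to each entry and compress to the vectors δ_{g_i} in the i-th copy of ℓ²(Γ): the
result is (φ_T(g_i g_j⁻¹) X i j). Hence the Schur norm of φ_T is at most ‖T‖_cb
(`isSchurBounded_symbolOf`). For the multiplier map of φ the symbol is φ itself.

These functions need not be finitely supported, but they are Schur norm limits of finitely supported
ones: elements of A(Γ) because the Fourier–Stieltjes norm dominates the Schur norm, symbols of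
finite rank maps because they are square summable. Truncating and then rescaling keeps the constant
c (`hasSchurApproximation_of_forall`).

From functions to maps: a finitely supported φ gives the finite rank map `multiplierMap` on both
algebras. In the canonical basis of ℓ²(Γ)ⁿ it acts as a Schur multiplier, so its cb norm is at most
c (`cbNorm_multiplierMap_le`). Uniform boundedness then upgrades φ_i → 1 to norm convergence on
C⋆_λ(Γ), by density, and to weak⋆ convergence on LΓ, by dominated convergence. -/

namespace CowlingHaagerup

open scoped ComplexConjugate InnerProductSpace

/-! ### Bounded sesquilinear forms given by finite matrices -/

section FormBound

variable {κ : Type*} [Fintype κ]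

/-- The finite complex matrix `X` has operator norm at most `c` on `ℓ²`, phrased through the
associated sesquilinear form. -/
def FormBound (X : κ → κ → ℂ) (c : ℝ) : Prop :=
  ∀ α β : κ → ℂ, ‖∑ i, ∑ j, X i j * (conj (β i) * α j)‖ ≤
    c * (√(∑ j, ‖α j‖ ^ 2) * √(∑ i, ‖β i‖ ^ 2))

theorem FormBound.mono {X : κ → κ → ℂ} {c d : ℝ} (h : FormBound X c) (hcd : c ≤ d) :
    FormBound X d :=
  fun α β => (h α β).trans (by gcongr)

theorem FormBound.add {X Y : κ → κ → ℂ} {c d : ℝ} (hX : FormBound X c) (hY : FormBound Y d) :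
    FormBound (fun i j => X i j + Y i j) (c + d) := by
  intro α β
  simp only [add_mul, Finset.sum_add_distrib]
  exact (norm_add_le _ _).trans (add_le_add (hX α β) (hY α β))

theorem FormBound.smul {X : κ → κ → ℂ} {c : ℝ} (hX : FormBound X c) (z : ℂ) :
    FormBound (fun i j => z * X i j) (‖z‖ * c) := by
  intro α β
  simp only [mul_assoc, ← Finset.mul_sum]
  rw [norm_mul]
  gcongr
  simpa only [mul_assoc] using hX α β

theorem FormBound.comp_equiv {κ' : Type*} [Fintype κ'] {X : κ → κ → ℂ} {c : ℝ}
    (hX : FormBound X c) (e : κ' ≃ κ) : FormBound (fun i j => X (e i) (e j)) c := by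
  intro α β
  have h := hX (α ∘ e.symm) (β ∘ e.symm)
  rw [← e.sum_comp, ← e.sum_comp (fun j => ‖(α ∘ e.symm) j‖ ^ 2),
    ← e.sum_comp (fun j => ‖(β ∘ e.symm) j‖ ^ 2)] at h
  simp_rw [← e.sum_comp (fun j => X _ j * _)] at h
  simpa using h

/-- A scalar matrix that is bounded on `ℓ²` is bounded, by the same constant, on `ℓ²`-sums of a
Hilbert space. -/
theorem FormBound.norm_sum_inner_le {E : Type*} [NormedAddCommGroup E] [InnerProductSpace ℂ E]
    {X : κ → κ → ℂ} {c : ℝ} (hX : FormBound X c) (hc : 0 ≤ c) (u v : κ → E) :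
    ‖∑ i, ∑ j, X i j * inner ℂ (v i) (u j)‖ ≤
      c * (√(∑ j, ‖u j‖ ^ 2) * √(∑ i, ‖v i‖ ^ 2)) := by
  -- Only the span of the finitely many vectors matters. In an orthonormal basis of it the sum
  -- splits into one scalar form per coordinate; the bounds are recombined by Cauchy–Schwarz over
  -- the coordinates.
  let W : Submodule ℂ E := Submodule.span ℂ (Set.range u ∪ Set.range v)
  have : FiniteDimensional ℂ W :=
    FiniteDimensional.span_of_finite ℂ ((Set.finite_range u).union (Set.finite_range v))
  let u' : κ → W := fun j => ⟨u j, Submodule.subset_span (Or.inl ⟨j, rfl⟩)⟩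
  let v' : κ → W := fun j => ⟨v j, Submodule.subset_span (Or.inr ⟨j, rfl⟩)⟩
  let b := stdOrthonormalBasis ℂ W
  have hn : ∀ w : W, ‖w‖ ^ 2 = ∑ k, ‖(inner ℂ (b k) w : ℂ)‖ ^ 2 := fun w =>
    (b.sum_sq_norm_inner_right w).symm
  have hu : ∑ j, ‖u j‖ ^ 2 = ∑ k, ∑ j, ‖(inner ℂ (b k) (u' j) : ℂ)‖ ^ 2 := by
    rw [Finset.sum_comm]
    exact Finset.sum_congr rfl fun j _ => hn (u' j)
  have hv : ∑ j, ‖v j‖ ^ 2 = ∑ k, ∑ j, ‖(inner ℂ (b k) (v' j) : ℂ)‖ ^ 2 := by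
    rw [Finset.sum_comm]
    exact Finset.sum_congr rfl fun j _ => hn (v' j)
  have hinner : ∀ i j, inner ℂ (v i) (u j) =
      ∑ k, conj (inner ℂ (b k) (v' i) : ℂ) * inner ℂ (b k) (u' j) := by
    intro i j
    simp only [inner_conj_symm]
    exact (b.sum_inner_mul_inner (v' i) (u' j)).symm
  have hsum : ∑ i, ∑ j, X i j * inner ℂ (v i) (u j) =
      ∑ k, ∑ i, ∑ j, X i j * (conj (inner ℂ (b k) (v' i) : ℂ) * inner ℂ (b k) (u' j)) := by
    simp_rw [hinner, Finset.mul_sum]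
    exact (Finset.sum_congr rfl fun _ _ => Finset.sum_comm).trans Finset.sum_comm
  rw [hsum, hu, hv]
  calc _ ≤ ∑ k, c * (√(∑ j, ‖(inner ℂ (b k) (u' j) : ℂ)‖ ^ 2) *
        √(∑ i, ‖(inner ℂ (b k) (v' i) : ℂ)‖ ^ 2)) :=
        norm_sum_le_of_le _ fun k _ => hX _ _
    _ ≤ _ := by
        rw [← Finset.mul_sum]
        refine mul_le_mul_of_nonneg_left ?_ hc
        exact Real.sum_sqrt_mul_sqrt_le _ (fun _ => by positivity) (fun _ => by positivity)

end FormBound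

/-! ### Operator norms through matrix coefficients, and convergence on dense spans -/

section Operators

variable {E : Type*} [NormedAddCommGroup E] [InnerProductSpace ℂ E]

theorem opNorm_le_of_norm_inner_le {A : E →L[ℂ] E} {c : ℝ} (hc : 0 ≤ c)
    (h : ∀ ξ η, ‖(inner ℂ η (A ξ) : ℂ)‖ ≤ c * (‖ξ‖ * ‖η‖)) : ‖A‖ ≤ c := by
  refine ContinuousLinearMap.opNorm_le_of_re_inner_le hc fun x y hx hy => ?_
  refine (RCLike.re_le_norm _).trans ?_
  rw [norm_inner_symm]
  simpa [hx, hy] using h x y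

theorem norm_inner_apply_le {A : E →L[ℂ] E} {c : ℝ} (h : ‖A‖ ≤ c) (ξ η : E) :
    ‖(inner ℂ η (A ξ) : ℂ)‖ ≤ c * (‖ξ‖ * ‖η‖) := by
  calc _ ≤ ‖η‖ * ‖A ξ‖ := norm_inner_le_norm _ _
    _ ≤ ‖η‖ * (c * ‖ξ‖) := by gcongr; exact A.le_of_opNorm_le h ξ
    _ = _ := by ring

theorem Orthonormal.norm_sum_eq {κ : Type*} [Fintype κ] {e : κ → E} (he : Orthonormal ℂ e)
    (α : κ → ℂ) : ‖∑ i, α i • e i‖ = √(∑ i, ‖α i‖ ^ 2) := by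
  rw [norm_eq_sqrt_re_inner (𝕜 := ℂ), he.inner_sum]
  congr 1
  simp [Complex.conj_mul', ← Complex.ofReal_pow]

theorem inner_sum_apply_sum {κ : Type*} [Fintype κ] (A : E →L[ℂ] E) (e : κ → E) (α β : κ → ℂ) :
    (inner ℂ (∑ i, β i • e i) (A (∑ j, α j • e j)) : ℂ) =
      ∑ i, ∑ j, inner ℂ (e i) (A (e j)) * (conj (β i) * α j) := by
  rw [sum_inner]
  simp only [map_sum, map_smul, inner_sum, inner_smul_left, inner_smul_right]
  refine Finset.sum_congr rfl fun i _ => Finset.sum_congr rfl fun j _ => ?_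
  ring

theorem formBound_of_orthonormal {κ : Type*} [Fintype κ] {e : κ → E} (he : Orthonormal ℂ e)
    {A : E →L[ℂ] E} {c : ℝ} (h : ‖A‖ ≤ c) :
    FormBound (fun i j => inner ℂ (e i) (A (e j))) c := by
  intro α β
  rw [← inner_sum_apply_sum, ← Orthonormal.norm_sum_eq he, ← Orthonormal.norm_sum_eq he]
  exact norm_inner_apply_le h _ _

/-- Partial sums of the basis expansions converge in norm, so ⟨Aξ, η⟩ is a limit of finite forms; by
Bessel the coefficient vectors never exceed ‖ξ‖ and ‖η‖. -/
theorem opNorm_le_of_formBound {ι : Type*} (b : HilbertBasis ι ℂ E) {A : E →L[ℂ] E} {c : ℝ}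
    (hc : 0 ≤ c)
    (h : ∀ G : Finset ι, FormBound (fun p q : G => inner ℂ (b p) (A (b q))) c) : ‖A‖ ≤ c := by
  refine opNorm_le_of_norm_inner_le hc fun ξ η => ?_
  have hξ := b.hasSum_repr ξ
  have hη := b.hasSum_repr η
  have hlim : Tendsto (fun G : Finset ι =>
      ‖(inner ℂ (∑ i ∈ G, b.repr η i • b i) (A (∑ i ∈ G, b.repr ξ i • b i)) : ℂ)‖) atTop
      (𝓝 ‖(inner ℂ η (A ξ) : ℂ)‖) :=
    (Tendsto.inner hη ((A.continuous.tendsto _).comp hξ)).norm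
  refine le_of_tendsto' hlim fun G => ?_
  have hB : ∀ x : E, √(∑ i : G, ‖b.repr x i‖ ^ 2) ≤ ‖x‖ := by
    intro x
    rw [Finset.sum_coe_sort G (fun i => ‖b.repr x i‖ ^ 2)]
    refine Real.sqrt_le_iff.2 ⟨norm_nonneg _, ?_⟩
    simp only [b.repr_apply_apply]
    exact b.orthonormal.sum_inner_products_le x
  rw [← Finset.sum_coe_sort G (fun i => b.repr ξ i • b i),
    ← Finset.sum_coe_sort G (fun i => b.repr η i • b i), 
    inner_sum_apply_sum A (fun i : G => b i)]
  refine (h G _ _).trans ?_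
  gcongr <;> exact hB _

theorem inner_blockOp {H : Type*} [NormedAddCommGroup H] [InnerProductSpace ℂ H] {n : Type*}
    [Fintype n] (x : Matrix n n (H →L[ℂ] H)) (ξ η : PiLp 2 (fun _ : n => H)) :
    (inner ℂ η (blockOp x ξ) : ℂ) = ∑ i, ∑ j, inner ℂ (η i) (x i j (ξ j)) := by
  simp [PiLp.inner_apply, inner_sum]

/-- Linear maps that are uniformly bounded with respect to `p` and converge to `0` on a set whose
span is dense with respect to `p` converge to `0` everywhere. -/
theorem tendsto_zero_of_forall_exists_span {ι V F : Type*} [AddCommGroup V] [Module ℂ V]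
    [NormedAddCommGroup F] [NormedSpace ℂ F] {l : Filter ι} (f : ι → V →ₗ[ℂ] F) {c : ℝ} {p : V → ℝ}
    (hp : ∀ x, 0 ≤ p x) (hf : ∀ i x, ‖f i x‖ ≤ c * p x) {S : Set V}
    (hS : ∀ x, ∀ ε > 0, ∃ y ∈ Submodule.span ℂ S, p (x - y) < ε)
    (h : ∀ x ∈ S, Tendsto (fun i => f i x) l (𝓝 0)) (x : V) :
    Tendsto (fun i => f i x) l (𝓝 0) := by
  have hspan : ∀ y ∈ Submodule.span ℂ S, Tendsto (fun i => f i y) l (𝓝 0) := by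
    intro y hy
    induction hy using Submodule.span_induction with
    | mem y hy => exact h y hy
    | zero => simpa using tendsto_const_nhds
    | add y z _ _ hy hz => simpa using hy.add hz
    | smul a y _ hy => simpa using hy.const_smul a
  rw [Metric.tendsto_nhds]
  intro ε hε
  -- The sign of c is not known, and |c| may vanish; |c| + 1 is a safe divisor that still dominates
  -- c.
  have hc : 0 < |c| + 1 := by positivity
  obtain ⟨y, hy, hxy⟩ := hS x (ε / 2 / (|c| + 1)) (by positivity)
  filter_upwards [Metric.tendsto_nhds.1 (hspan y hy) (ε / 2) (by positivity)] with i hi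
  rw [dist_zero_right] at hi ⊢
  rw [lt_div_iff₀ hc] at hxy
  calc ‖f i x‖ = ‖f i (x - y) + f i y‖ := by rw [map_sub, sub_add_cancel]
    _ ≤ ‖f i (x - y)‖ + ‖f i y‖ := norm_add_le _ _
    _ < ε / 2 + ε / 2 := by
        refine add_lt_add ((hf i _).trans_lt (lt_of_le_of_lt ?_ hxy)) hi
        rw [mul_comm]
        exact mul_le_mul_of_nonneg_left ((le_abs_self c).trans (by linarith)) (hp _)
    _ = ε := by ring

/-- Uniformly bounded linear maps that converge to `0` on a set with dense span converge to `0`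
everywhere. -/
theorem tendsto_zero_of_dense_span {ι V F : Type*} [NormedAddCommGroup V] [Module ℂ V]
    [NormedAddCommGroup F] [NormedSpace ℂ F] {l : Filter ι} (f : ι → V →ₗ[ℂ] F) {c : ℝ}
    (hf : ∀ i x, ‖f i x‖ ≤ c * ‖x‖) {S : Set V} (hS : Dense (Submodule.span ℂ S : Set V))
    (h : ∀ x ∈ S, Tendsto (fun i => f i x) l (𝓝 0)) (x : V) :
    Tendsto (fun i => f i x) l (𝓝 0) := by
  refine tendsto_zero_of_forall_exists_span f (fun x => norm_nonneg x) hf (fun x ε hε => ?_) h x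
  simpa only [dist_eq_norm, SetLike.mem_coe] using Metric.mem_closure_iff.1 (hS x) ε hε

end Operators

/-! ### Bounded Schur multipliers of a group -/

section Schur

variable {Γ : Type*} [Group Γ]

/-- The Schur multiplier with symbol `φ(s t⁻¹)` has completely bounded norm at most `c`. -/
def IsSchurBounded (φ : Γ → ℂ) (c : ℝ) : Prop :=
  ∀ (m : ℕ) (g : Fin m → Γ) (X : Fin m → Fin m → ℂ), FormBound X 1 →
    FormBound (fun i j => φ (g i * (g j)⁻¹) * X i j) c

theorem IsSchurBounded.formBound {φ : Γ → ℂ} {c : ℝ} (hφ : IsSchurBounded φ c) {κ : Type*}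
    [Fintype κ] (g : κ → Γ) {X : κ → κ → ℂ} (hX : FormBound X 1) :
    FormBound (fun i j => φ (g i * (g j)⁻¹) * X i j) c := by
  have h := (hφ _ (g ∘ (Fintype.equivFin κ).symm) _
    (hX.comp_equiv (Fintype.equivFin κ).symm)).comp_equiv (Fintype.equivFin κ)
  simpa using h

theorem IsSchurBounded.mono {φ : Γ → ℂ} {c d : ℝ} (h : IsSchurBounded φ c) (hcd : c ≤ d) :
    IsSchurBounded φ d :=
  fun m g X hX => (h m g X hX).mono hcd

theorem IsSchurBounded.add {φ ψ : Γ → ℂ} {c d : ℝ} (hφ : IsSchurBounded φ c)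
    (hψ : IsSchurBounded ψ d) : IsSchurBounded (φ + ψ) (c + d) := by
  intro m g X hX
  simpa only [Pi.add_apply, add_mul] using (hφ m g X hX).add (hψ m g X hX)

theorem IsSchurBounded.smul {φ : Γ → ℂ} {c : ℝ} (hφ : IsSchurBounded φ c) (z : ℂ) :
    IsSchurBounded (z • φ) (‖z‖ * c) := by
  intro m g X hX
  simpa only [Pi.smul_apply, smul_eq_mul, mul_assoc] using (hφ m g X hX).smul z

theorem isSchurBounded_zero : IsSchurBounded (0 : Γ → ℂ) 0 := by
  intro m g X _ α β
  simp

/-- Needed because `cbMultiplierNorm` is an infimum: a bound by c only provides maps of cb norm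
below each d > c. -/
theorem IsSchurBounded.of_forall_lt {φ : Γ → ℂ} {c : ℝ}
    (h : ∀ d, c < d → IsSchurBounded φ d) : IsSchurBounded φ c := by
  intro m g X hX α β
  have hlim : Tendsto (fun d => d * (√(∑ j, ‖α j‖ ^ 2) * √(∑ i, ‖β i‖ ^ 2))) (𝓝[>] c)
      (𝓝 (c * (√(∑ j, ‖α j‖ ^ 2) * √(∑ i, ‖β i‖ ^ 2)))) :=
    ((continuous_id.mul continuous_const).tendsto c).mono_left nhdsWithin_le_nhds
  refine ge_of_tendsto hlim ?_
  filter_upwards [self_mem_nhdsWithin] with d hd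
  exact h d hd m g X hX α β

theorem IsSchurBounded.norm_apply_le {φ : Γ → ℂ} {c : ℝ} (hφ : IsSchurBounded φ c) (s : Γ) :
    ‖φ s‖ ≤ c := by
  -- The matrix unit at (0, 1), used with the group elements (s, 1), isolates the single value φ(s).
  have hX : FormBound (fun i j : Fin 2 => if i = 0 ∧ j = 1 then (1 : ℂ) else 0) 1 := by
    intro α β
    simp only [Fin.sum_univ_two]
    simp only [Fin.isValue, zero_ne_one, and_false, if_false, zero_mul, and_self, if_true, one_mul,
      zero_add, one_ne_zero, false_and, add_zero, norm_mul, RCLike.norm_conj, one_mul]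
    rw [mul_comm]
    gcongr <;> apply Real.le_sqrt_of_sq_le <;> nlinarith [sq_nonneg ‖α 0‖, sq_nonneg ‖β 1‖]
  have h := hφ.formBound ![s, 1] hX ![0, 1] ![1, 0]
  simpa [Fin.sum_univ_two] using h

/-- Factors the kernel φ(s t⁻¹) of a coefficient φ through Hilbert space vectors depending on s
alone and on t alone; this is what makes coefficients Schur multipliers. -/
theorem inner_unitary_mul_inv {H : Type*} [NormedAddCommGroup H] [InnerProductSpace ℂ H]
    [CompleteSpace H] (π : Γ →* unitary (H →L[ℂ] H)) (s t : Γ) (ξ η : H) :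
    inner ℂ η ((π (s * t⁻¹) : H →L[ℂ] H) ξ) =
      inner ℂ ((π s⁻¹ : H →L[ℂ] H) η) ((π t⁻¹ : H →L[ℂ] H) ξ) := by
  rw [← Unitary.inner_map_map (π s⁻¹) η]
  congr 1
  change ((π s⁻¹ * π (s * t⁻¹) : unitary (H →L[ℂ] H)) : H →L[ℂ] H) ξ = _
  rw [← map_mul, inv_mul_cancel_left]

/-- Coefficients of unitary representations are bounded Schur multipliers. -/
theorem isSchurBounded_coefficient {H : Type*} [NormedAddCommGroup H] [InnerProductSpace ℂ H]
    [CompleteSpace H] (π : Γ →* unitary (H →L[ℂ] H)) (ξ η : H) :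
    IsSchurBounded (fun s => inner ℂ η ((π s : H →L[ℂ] H) ξ)) (‖ξ‖ * ‖η‖) := by
  have hnorm : ∀ s (x : H), ‖(π s : H →L[ℂ] H) x‖ = ‖x‖ := fun s x =>
    Unitary.norm_map (π s) x
  intro m g X hX α β
  -- After the factorisation of the kernel, α and β are absorbed into the vectors, and the scalar
  -- bound on X is used for Hilbert space vectors.
  have h := hX.norm_sum_inner_le zero_le_one (fun j => α j • (π (g j)⁻¹ : H →L[ℂ] H) ξ)
    (fun i => β i • (π (g i)⁻¹ : H →L[ℂ] H) η)
  calc _ = ‖∑ i, ∑ j, X i j * inner ℂ (β i • (π (g i)⁻¹ : H →L[ℂ] H) η)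
        (α j • (π (g j)⁻¹ : H →L[ℂ] H) ξ)‖ := by
        congr 1
        refine Finset.sum_congr rfl fun i _ => Finset.sum_congr rfl fun j _ => ?_
        simp only [inner_unitary_mul_inv π, inner_smul_left, inner_smul_right]
        ring
    _ ≤ _ := h
    _ = _ := by
        simp only [norm_smul, hnorm, mul_pow, ← Finset.sum_mul]
        rw [Real.sqrt_mul (by positivity), Real.sqrt_mul (by positivity),
          Real.sqrt_sq (norm_nonneg _), Real.sqrt_sq (norm_nonneg _)]
        ring

end Schur

/-! ### The canonical basis of `ℓ²(Γ)` -/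

section Delta

variable {Γ : Type*}

open Classical in
/-- The canonical basis vector `δ_r` of `ℓ²(Γ)`. -/
noncomputable def delta (r : Γ) : EllTwo Γ := lp.single 2 r (1 : ℂ)

open Classical in
theorem delta_apply (r t : Γ) : delta r t = if t = r then 1 else 0 := by
  simp [delta, lp.single_apply, Pi.single_apply]

theorem inner_delta_left (r : Γ) (f : EllTwo Γ) : (inner ℂ (delta r) f : ℂ) = f r := by
  classical
  simp [delta, lp.inner_single_left]

theorem orthonormal_delta : Orthonormal ℂ (delta : Γ → EllTwo Γ) := by
  classical
  rw [orthonormal_iff_ite]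
  intro i j
  rw [inner_delta_left, delta_apply]

theorem norm_delta (r : Γ) : ‖(delta r : EllTwo Γ)‖ = 1 := orthonormal_delta.1 r

theorem norm_apply_le (f : EllTwo Γ) (r : Γ) : ‖f r‖ ≤ ‖f‖ := by
  rw [← inner_delta_left]
  simpa [norm_delta] using norm_inner_le_norm (𝕜 := ℂ) (delta r) f

theorem dense_span_delta : Dense (Submodule.span ℂ (Set.range (delta : Γ → EllTwo Γ)) :
    Set (EllTwo Γ)) := by
  classical
  intro f
  refine mem_closure_of_tendsto (lp.hasSum_single (by simp) f) (Eventually.of_forall fun s => ?_)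
  refine sum_mem fun r _ => ?_
  have : lp.single 2 r (f r) = f r • delta r := by
    ext t
    simp only [lp.coeFn_smul, Pi.smul_apply, delta_apply, lp.single_apply, Pi.single_apply]
    split_ifs with h
    · subst h; simp
    · simp
  rw [this]
  exact Submodule.smul_mem _ _ (Submodule.subset_span ⟨r, rfl⟩)

open Classical in
/-- The canonical basis of the direct sum of `n` copies of `ℓ²(Γ)`. -/
noncomputable def deltaBlock {n : ℕ} (p : Fin n × Γ) : PiLp 2 (fun _ : Fin n => EllTwo Γ) :=
  PiLp.single 2 p.1 (delta p.2)

theorem deltaBlock_apply {n : ℕ} (p : Fin n × Γ) (i : Fin n) :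
    deltaBlock p i = if i = p.1 then delta p.2 else 0 := by
  simp only [deltaBlock]
  split_ifs with h
  · subst h; exact PiLp.single_eq_same ..
  · exact PiLp.single_eq_of_ne _ h _

theorem inner_deltaBlock_left {n : ℕ} (p : Fin n × Γ) (f : PiLp 2 (fun _ : Fin n => EllTwo Γ)) :
    (inner ℂ (deltaBlock p) f : ℂ) = f p.1 p.2 := by
  rw [PiLp.inner_apply, Finset.sum_eq_single p.1]
  · simp [deltaBlock_apply, inner_delta_left]
  · intro i _ hi
    simp [deltaBlock_apply, hi]
  · simp

theorem orthonormal_deltaBlock {n : ℕ} :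
    Orthonormal ℂ (deltaBlock : Fin n × Γ → PiLp 2 (fun _ : Fin n => EllTwo Γ)) := by
  classical
  rw [orthonormal_iff_ite]
  rintro ⟨i, t⟩ ⟨j, r⟩
  rw [inner_deltaBlock_left, deltaBlock_apply]
  by_cases h : i = j
  · subst h; simp [delta_apply]
  · simp [h]

/-- The canonical Hilbert basis of the direct sum of `n` copies of `ℓ²(Γ)`. -/
noncomputable def deltaBasis (Γ : Type*) (n : ℕ) :
    HilbertBasis (Fin n × Γ) ℂ (PiLp 2 (fun _ : Fin n => EllTwo Γ)) :=
  HilbertBasis.mkOfOrthogonalEqBot orthonormal_deltaBlock <| by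
    rw [eq_bot_iff]
    intro f hf
    rw [Submodule.mem_bot]
    ext i t
    rw [← inner_deltaBlock_left (i, t) f]
    exact (Submodule.mem_orthogonal _ _).1 hf _ (Submodule.subset_span ⟨_, rfl⟩)

/-- Turns a matrix of operators into one scalar matrix indexed by `Fin n × Γ`, so that applying a
multiplier to each block becomes Schur multiplication. -/
theorem inner_deltaBasis_blockOp {n : ℕ} (x : Fin n → Fin n → EllTwo Γ →L[ℂ] EllTwo Γ)
    (p q : Fin n × Γ) :
    (inner ℂ (deltaBasis Γ n p) (blockOp x (deltaBasis Γ n q)) : ℂ) =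
      x p.1 q.1 (delta q.2) p.2 := by
  rw [deltaBasis, HilbertBasis.coe_mkOfOrthogonalEqBot, inner_deltaBlock_left]
  refine congrArg (fun f : EllTwo Γ => f p.2) ((blockOp_apply x _ p.1).trans ?_)
  rw [Finset.sum_eq_single q.1]
  · simp [deltaBlock_apply]
  · intro j _ hj
    simp [deltaBlock_apply, hj]
  · simp

end Delta

/-! ### Operators commuting with right translations -/

section Convolution

variable {Γ : Type*} [Group Γ]

theorem leftRegular_delta (s r : Γ) :
    (leftRegular Γ s : EllTwo Γ →L[ℂ] EllTwo Γ) (delta r) = delta (s * r) := by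
  ext t
  rw [leftRegular_apply, delta_apply, delta_apply]
  congr 1
  exact propext inv_mul_eq_iff_eq_mul

/-- The matrix coefficients of the operator `z` depend on `t r⁻¹` only. -/
def IsConvolution (z : EllTwo Γ →L[ℂ] EllTwo Γ) : Prop :=
  ∀ r t, z (delta r) t = z (delta 1) (t * r⁻¹)

theorem isConvolution_of_mem_groupAlgebraImage {z : EllTwo Γ →L[ℂ] EllTwo Γ}
    (hz : z ∈ groupAlgebraImage Γ) : IsConvolution z := by
  obtain ⟨f, rfl⟩ := hz
  change IsConvolution (leftRegularAlg Γ f)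
  intro r t
  induction f using MonoidAlgebra.induction_linear with
  | zero => simp
  | add f g hf hg => simp [hf, hg]
  | single s c =>
    simp only [leftRegularAlg_single, smul_apply, leftRegular_delta,
      lp.coeFn_smul, Pi.smul_apply, delta_apply, mul_one]
    congr 2
    exact propext (mul_inv_eq_iff_eq_mul).symm

/-- Each matrix coefficient is continuous for the strong operator topology, so the identity passes
from λ(ℂ[Γ]) to the closure; testing on the two vectors δ_r and δ_1 suffices. -/
theorem isConvolution_of_mem_sotClosure {z : EllTwo Γ →L[ℂ] EllTwo Γ}
    (hz : z ∈ sotClosure (groupAlgebraImage Γ : Set (EllTwo Γ →L[ℂ] EllTwo Γ))) :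
    IsConvolution z := by
  classical
  intro r t
  rw [← sub_eq_zero, ← norm_eq_zero]
  refine le_antisymm (le_of_forall_pos_le_add fun ε hε => ?_) (norm_nonneg _)
  obtain ⟨a, ha, hb⟩ := mem_sotClosure_iff.1 hz {delta r, delta 1} (ε / 2) (by positivity)
  have h1 := (norm_apply_le _ t).trans (hb (delta r) (by simp)).le
  have h2 := (norm_apply_le _ (t * r⁻¹)).trans (hb (delta 1) (by simp)).le
  have h3 := isConvolution_of_mem_groupAlgebraImage ha r t
  simp only [lp.coeFn_sub, Pi.sub_apply] at h1 h2
  have e : z (delta r) t - z (delta 1) (t * r⁻¹) =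
      (a (delta 1) (t * r⁻¹) - z (delta 1) (t * r⁻¹)) - (a (delta r) t - z (delta r) t) := by
    rw [h3]; ring
  rw [e]
  exact (norm_sub_le _ _).trans (by linarith)

theorem isConvolution_of_mem_groupVonNeumannAlgebra {z : EllTwo Γ →L[ℂ] EllTwo Γ}
    (hz : z ∈ toSubmodule (groupVonNeumannAlgebra Γ)) : IsConvolution z :=
  isConvolution_of_mem_sotClosure hz

theorem isConvolution_of_mem_reducedGroupCStarAlgebra {z : EllTwo Γ →L[ℂ] EllTwo Γ}
    (hz : z ∈ (reducedGroupCStarAlgebra Γ).toSubmodule) : IsConvolution z := by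
  have hz' : z ∈ closure (groupAlgebraImage Γ : Set (EllTwo Γ →L[ℂ] EllTwo Γ)) := hz
  refine isConvolution_of_mem_sotClosure (mem_sotClosure_iff.2 fun F ε hε => ?_)
  -- A common bound for the norms of all test vectors, showing that the norm closure lies in the
  -- strong closure.
  have hM : 0 < 1 + ∑ ξ ∈ F, ‖ξ‖ := by positivity
  obtain ⟨a, ha, hb⟩ := Metric.mem_closure_iff.1 hz' (ε / (1 + ∑ ξ ∈ F, ‖ξ‖)) (by positivity)
  refine ⟨a, ha, fun ξ hξ => ?_⟩
  rw [dist_eq_norm, norm_sub_rev, lt_div_iff₀ hM] at hb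
  calc ‖a ξ - z ξ‖ = ‖(a - z) ξ‖ := rfl
    _ ≤ ‖a - z‖ * ‖ξ‖ := (a - z).le_opNorm ξ
    _ ≤ ‖a - z‖ * (1 + ∑ ξ ∈ F, ‖ξ‖) := by
        gcongr
        exact (Finset.single_le_sum (f := fun ξ => ‖ξ‖) (fun _ _ => norm_nonneg _) hξ).trans
          (le_add_of_nonneg_left zero_le_one)
    _ < ε := hb

theorem leftRegular_mem_reducedGroupCStarAlgebra (s : Γ) :
    (leftRegular Γ s : EllTwo Γ →L[ℂ] EllTwo Γ) ∈ (reducedGroupCStarAlgebra Γ).toSubmodule :=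
  subset_closure (leftRegular_mem_groupAlgebraImage Γ s)

theorem norm_leftRegular_le (s : Γ) : ‖(leftRegular Γ s : EllTwo Γ →L[ℂ] EllTwo Γ)‖ ≤ 1 :=
  ContinuousLinearMap.opNorm_le_bound _ zero_le_one fun x => by
    rw [one_mul]; exact (Unitary.norm_map (leftRegular Γ s) x).le

end Convolution

/-! ### Schur multipliers from completely bounded maps -/

section FromMaps

theorem enorm_le_coe_iff {E : Type*} [SeminormedAddCommGroup E] {x : E} {c : ℝ≥0} :
    ‖x‖ₑ ≤ c ↔ ‖x‖ ≤ c := by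
  rw [enorm_eq_nnnorm, ENNReal.coe_le_coe, ← NNReal.coe_le_coe, coe_nnnorm]

theorem norm_blockOp_map_le {H : Type*} [NormedAddCommGroup H] [InnerProductSpace ℂ H]
    {V : Submodule ℂ (H →L[ℂ] H)} {T : V →ₗ[ℂ] V} {c : ℝ≥0} (hT : cbNorm T ≤ c) {n : ℕ}
    {x : Fin n → Fin n → V} (hx : ‖blockOp (fun i j => (x i j : H →L[ℂ] H))‖ ≤ 1) :
    ‖blockOp (fun i j => (T (x i j) : H →L[ℂ] H))‖ ≤ c := by
  simp only [cbNorm, iSup_le_iff] at hT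
  exact enorm_le_coe_iff.1 (hT n x hx)

theorem norm_blockOp_fin_one {H : Type*} [NormedAddCommGroup H] [InnerProductSpace ℂ H]
    (x : Fin 1 → Fin 1 → H →L[ℂ] H) : ‖blockOp (n := Fin 1) x‖ = ‖x 0 0‖ := by
  have hn : ∀ ξ : PiLp 2 (fun _ : Fin 1 => H), ‖ξ‖ = ‖ξ 0‖ := fun ξ => by
    simp [PiLp.norm_eq_of_L2]
  have hb : ∀ ξ : PiLp 2 (fun _ : Fin 1 => H), blockOp (n := Fin 1) x ξ 0 = x 0 0 (ξ 0) :=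
    fun ξ => (blockOp_apply (n := Fin 1) x ξ 0).trans (by simp)
  refine le_antisymm (ContinuousLinearMap.opNorm_le_bound _ (norm_nonneg (x 0 0)) fun ξ => ?_)
    (ContinuousLinearMap.opNorm_le_bound _ (norm_nonneg (blockOp (n := Fin 1) x)) fun ξ => ?_)
  · rw [hn, hn, hb]
    exact (x 0 0).le_opNorm (ξ 0)
  · have h := (blockOp (n := Fin 1) x).le_opNorm (WithLp.toLp 2 fun _ => ξ)
    rwa [hn, hn, hb] at h

/-- A completely bounded map is bounded. -/
theorem norm_map_le {H : Type*} [NormedAddCommGroup H] [InnerProductSpace ℂ H]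
    {V : Submodule ℂ (H →L[ℂ] H)} {T : V →ₗ[ℂ] V} {c : ℝ≥0} (hT : cbNorm T ≤ c) (x : V) :
    ‖(T x : H →L[ℂ] H)‖ ≤ c * ‖(x : H →L[ℂ] H)‖ := by
  have h1 : ∀ x : V, ‖(x : H →L[ℂ] H)‖ ≤ 1 → ‖(T x : H →L[ℂ] H)‖ ≤ c := fun x hx =>
    (norm_blockOp_fin_one fun _ _ => (T x : H →L[ℂ] H)).symm.trans_le
      (norm_blockOp_map_le hT (x := fun _ _ => x) ((norm_blockOp_fin_one _).trans_le hx))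
  rcases eq_or_ne x 0 with rfl | hx
  · simp
  have hx' : 0 < ‖(x : H →L[ℂ] H)‖ := norm_pos_iff.2 (by simpa using hx)
  have hn : ∀ y : V, ‖(((‖(x : H →L[ℂ] H)‖⁻¹ : ℝ) : ℂ) • y : H →L[ℂ] H)‖ =
      ‖(x : H →L[ℂ] H)‖⁻¹ * ‖(y : H →L[ℂ] H)‖ := by
    intro y
    rw [norm_smul, Complex.norm_real, norm_inv, norm_norm]
  have h := h1 (((‖(x : H →L[ℂ] H)‖⁻¹ : ℝ) : ℂ) • x)
    ((hn x).trans_le (inv_mul_cancel₀ hx'.ne').le)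
  rw [map_smul, Submodule.coe_smul, hn, inv_mul_le_iff₀ hx'] at h
  linarith

variable {Γ : Type*} [Group Γ] {V : Submodule ℂ (EllTwo Γ →L[ℂ] EllTwo Γ)}

/-- The function `s ↦ τ(T(λ(s)) λ(s)⋆)`, where `τ` is the canonical trace. -/
noncomputable def symbolOf (hV : ∀ s, (leftRegular Γ s : EllTwo Γ →L[ℂ] EllTwo Γ) ∈ V)
    (T : V →ₗ[ℂ] V) (s : Γ) : ℂ :=
  (T ⟨leftRegular Γ s, hV s⟩ : EllTwo Γ →L[ℂ] EllTwo Γ) (delta 1) s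

/-- The key transference: conjugating X ⊗ 1 by the diagonal unitary with entries λ(g_i) inserts
λ(g_i g_j⁻¹) without increasing the norm, and compressing the image under T recovers the Schur
product with the symbol. -/
theorem isSchurBounded_symbolOf (hV : ∀ s, (leftRegular Γ s : EllTwo Γ →L[ℂ] EllTwo Γ) ∈ V)
    (hconv : ∀ z ∈ V, IsConvolution z) {T : V →ₗ[ℂ] V} {c : ℝ≥0} (hT : cbNorm T ≤ c) :
    IsSchurBounded (symbolOf hV T) c := by
  intro m g X hX
  let x : Fin m → Fin m → V := fun i j => X i j • ⟨leftRegular Γ (g i * (g j)⁻¹), hV _⟩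
  have hx : ‖blockOp (fun i j => (x i j : EllTwo Γ →L[ℂ] EllTwo Γ))‖ ≤ 1 := by
    refine opNorm_le_of_norm_inner_le zero_le_one fun ξ η => ?_
    have h := hX.norm_sum_inner_le zero_le_one
      (fun j => (leftRegular Γ (g j)⁻¹ : EllTwo Γ →L[ℂ] EllTwo Γ) (ξ j))
      (fun i => (leftRegular Γ (g i)⁻¹ : EllTwo Γ →L[ℂ] EllTwo Γ) (η i))
    have hnorm : ∀ s (x : EllTwo Γ), ‖(leftRegular Γ s : EllTwo Γ →L[ℂ] EllTwo Γ) x‖ = ‖x‖ :=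
      fun s x => Unitary.norm_map (leftRegular Γ s) x
    simp only [hnorm] at h
    rw [← PiLp.norm_eq_of_L2, ← PiLp.norm_eq_of_L2] at h
    refine (congrArg norm (inner_blockOp _ ξ η)).trans_le ?_
    convert h using 6 with i _ j
    simp only [x, Submodule.coe_smul, smul_apply, inner_smul_right]
    congr 1
    exact inner_unitary_mul_inv (leftRegular Γ) _ _ _ _
  have hTx := norm_blockOp_map_le hT hx
  -- Distinct blocks make these vectors orthonormal even when g takes a value twice.
  have he : Orthonormal ℂ (fun i : Fin m => (deltaBlock (i, g i) :
      PiLp 2 (fun _ : Fin m => EllTwo Γ))) :=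
    orthonormal_deltaBlock.comp _ fun i j h => congrArg Prod.fst h
  have h := formBound_of_orthonormal he hTx
  have key : ∀ i j, (inner ℂ (deltaBlock (i, g i))
      (blockOp (fun i j => (T (x i j) : EllTwo Γ →L[ℂ] EllTwo Γ)) (deltaBlock (j, g j))) : ℂ) =
      symbolOf hV T (g i * (g j)⁻¹) * X i j := by
    intro i j
    have := inner_deltaBasis_blockOp (fun i j => (T (x i j) : EllTwo Γ →L[ℂ] EllTwo Γ))
      (i, g i) (j, g j)
    rw [deltaBasis, HilbertBasis.coe_mkOfOrthogonalEqBot] at this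
    rw [this]
    simp only [x, map_smul, Submodule.coe_smul, smul_apply, lp.coeFn_smul,
      Pi.smul_apply, smul_eq_mul, symbolOf]
    -- The coefficient at (g_i, g_j) of an operator in V equals the one at (g_i g_j⁻¹, 1), which is
    -- the value of the symbol.
    rw [hconv _ (T _).2, mul_comm]
  simpa only [key] using h

end FromMaps

/-! ### Approximation by finitely supported functions -/

section Approximable

variable {Γ : Type*} [Group Γ]

variable (Γ) in
/-- The functions that are limits, for the norm of Schur multipliers, of finitely supported
functions. -/
def finitelyApproximable : Submodule ℂ (Γ → ℂ) where
  carrier := {a | ∀ δ : ℝ, 0 < δ → ∃ b : Γ →₀ ℂ, IsSchurBounded (a - ⇑b) δ}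
  zero_mem' := fun δ hδ => ⟨0, by simpa using isSchurBounded_zero.mono hδ.le⟩
  add_mem' := by
    intro a a' ha ha' δ hδ
    obtain ⟨b, hb⟩ := ha (δ / 2) (by positivity)
    obtain ⟨b', hb'⟩ := ha' (δ / 2) (by positivity)
    refine ⟨b + b', ?_⟩
    have := hb.add hb'
    rwa [add_halves, ← add_sub_add_comm, ← Finsupp.coe_add] at this
  smul_mem' := by
    intro z a ha δ hδ
    obtain ⟨b, hb⟩ := ha (δ / (‖z‖ + 1)) (by positivity)
    refine ⟨z • b, ?_⟩
    have := (hb.smul z).mono (d := δ) (by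
      rw [← mul_div_assoc, div_le_iff₀ (by positivity)]
      nlinarith [norm_nonneg z])
    rwa [smul_sub, ← Finsupp.coe_smul] at this

theorem mem_finitelyApproximable_iff {a : Γ → ℂ} : a ∈ finitelyApproximable Γ ↔
    ∀ δ : ℝ, 0 < δ → ∃ b : Γ →₀ ℂ, IsSchurBounded (a - ⇑b) δ := Iff.rfl

/-- Closedness under Schur norm limits, by an ε/2 argument. -/
theorem mem_finitelyApproximable_of_forall {a : Γ → ℂ}
    (h : ∀ δ : ℝ, 0 < δ → ∃ b ∈ finitelyApproximable Γ, IsSchurBounded (a - b) δ) :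
    a ∈ finitelyApproximable Γ := by
  intro δ hδ
  obtain ⟨b, hb, hab⟩ := h (δ / 2) (by positivity)
  obtain ⟨c, hc⟩ := hb (δ / 2) (by positivity)
  refine ⟨c, ?_⟩
  have := hab.add hc
  rwa [add_halves, sub_add_sub_cancel] at this

/-- The coefficient `s ↦ ⟨λ(s) f, g⟩` of the regular representation. -/
noncomputable def coefficient (f g : EllTwo Γ) (s : Γ) : ℂ :=
  inner ℂ g ((leftRegular Γ s : EllTwo Γ →L[ℂ] EllTwo Γ) f)

theorem coefficient_delta_left (r : Γ) (g : EllTwo Γ) (s : Γ) :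
    coefficient (delta r) g s = conj (g (s * r)) := by
  rw [coefficient, leftRegular_delta, ← inner_conj_symm, inner_delta_left]

theorem isSchurBounded_coefficient_leftRegular (f g : EllTwo Γ) :
    IsSchurBounded (coefficient f g) (‖f‖ * ‖g‖) :=
  isSchurBounded_coefficient (leftRegular Γ) f g

theorem coefficient_mem_of_dense {g : EllTwo Γ} {S : Set (EllTwo Γ)}
    (hS : Dense (Submodule.span ℂ S : Set (EllTwo Γ)))
    (h : ∀ f ∈ S, coefficient f g ∈ finitelyApproximable Γ) (f : EllTwo Γ) :
    coefficient f g ∈ finitelyApproximable Γ := by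
  have hspan : ∀ f ∈ Submodule.span ℂ S, coefficient f g ∈ finitelyApproximable Γ := by
    intro f hf
    induction hf using Submodule.span_induction with
    | mem f hf => exact h f hf
    | zero =>
      convert zero_mem (finitelyApproximable Γ) using 1
      ext s; simp [coefficient]
    | add f f' _ _ hf hf' =>
      convert add_mem hf hf' using 1
      ext s; simp [coefficient]
    | smul z f _ hf =>
      convert Submodule.smul_mem _ z hf using 1
      ext s; simp [coefficient]
  refine mem_finitelyApproximable_of_forall fun δ hδ => ?_
  have hg : 0 < ‖g‖ + 1 := by positivity
  obtain ⟨f', hf', hff'⟩ := Metric.mem_closure_iff.1 (hS f) (δ / (‖g‖ + 1)) (by positivity)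
  rw [dist_eq_norm, lt_div_iff₀ hg] at hff'
  refine ⟨_, hspan f' hf', ?_⟩
  have hs : coefficient f g - coefficient f' g = coefficient (f - f') g := by
    ext s; simp [coefficient]
  rw [hs]
  refine (isSchurBounded_coefficient_leftRegular _ _).mono ?_
  nlinarith [norm_nonneg (f - f')]

theorem coefficient_mem_of_dense_right {f : EllTwo Γ} {S : Set (EllTwo Γ)}
    (hS : Dense (Submodule.span ℂ S : Set (EllTwo Γ)))
    (h : ∀ g ∈ S, coefficient f g ∈ finitelyApproximable Γ) (g : EllTwo Γ) :
    coefficient f g ∈ finitelyApproximable Γ := by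
  have hspan : ∀ g ∈ Submodule.span ℂ S, coefficient f g ∈ finitelyApproximable Γ := by
    intro g hg
    induction hg using Submodule.span_induction with
    | mem g hg => exact h g hg
    | zero =>
      convert zero_mem (finitelyApproximable Γ) using 1
      ext s; simp [coefficient]
    | add g g' _ _ hg hg' =>
      convert add_mem hg hg' using 1
      ext s; simp [coefficient]
    | smul z g _ hg =>
      -- The coefficient is antilinear in g.
      convert Submodule.smul_mem _ (conj z) hg using 1
      ext s; simp [coefficient, mul_comm]
  refine mem_finitelyApproximable_of_forall fun δ hδ => ?_
  have hf : 0 < ‖f‖ + 1 := by positivity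
  obtain ⟨g', hg', hgg'⟩ := Metric.mem_closure_iff.1 (hS g) (δ / (‖f‖ + 1)) (by positivity)
  rw [dist_eq_norm, lt_div_iff₀ hf] at hgg'
  refine ⟨_, hspan g' hg', ?_⟩
  have hs : coefficient f g - coefficient f g' = coefficient f (g - g') := by
    ext s; simp [coefficient]
  rw [hs]
  refine (isSchurBounded_coefficient_leftRegular _ _).mono ?_
  nlinarith [norm_nonneg (g - g')]

/-- The Schur norm of a coefficient is at most ‖f‖ ‖g‖, so sesquilinearity and density reduce to
basis vectors; the coefficient of δ_r and δ_t is the indicator of the single point t r⁻¹. -/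
theorem coefficient_mem_finitelyApproximable (f g : EllTwo Γ) :
    coefficient f g ∈ finitelyApproximable Γ := by
  classical
  refine coefficient_mem_of_dense_right dense_span_delta ?_ g
  rintro _ ⟨t, rfl⟩
  refine coefficient_mem_of_dense dense_span_delta ?_ f
  rintro _ ⟨r, rfl⟩
  refine mem_finitelyApproximable_iff.2 fun δ hδ => ⟨Finsupp.single (t * r⁻¹) 1, ?_⟩
  have : coefficient (delta r) (delta t) - ⇑(Finsupp.single (t * r⁻¹) (1 : ℂ)) = 0 := by
    ext s
    by_cases hs : s * r = t
    · subst hs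
      simp [coefficient_delta_left, delta_apply]
    · have : t * r⁻¹ ≠ s := fun h => hs (by rw [← h]; simp)
      simp [coefficient_delta_left, delta_apply, hs, Finsupp.single_eq_of_ne' this]
  rw [this]
  exact isSchurBounded_zero.mono hδ.le

/-- The vector g is the complex conjugate of φ. This puts ℓ²(Γ), and in particular every finitely
supported function, inside A(Γ). -/
theorem exists_coefficient_eq {φ : Γ → ℂ} (hφ : Memℓp φ 2) :
    ∃ g : EllTwo Γ, φ = coefficient (delta 1) g := by
  refine ⟨⟨fun s => conj (φ s), hφ.star_mem⟩, ?_⟩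
  ext s
  rw [coefficient_delta_left]
  simp

theorem mem_finitelyApproximable_of_memℓp {φ : Γ → ℂ} (hφ : Memℓp φ 2) :
    φ ∈ finitelyApproximable Γ := by
  obtain ⟨g, rfl⟩ := exists_coefficient_eq hφ
  exact coefficient_mem_finitelyApproximable _ _

theorem fourierStieltjesNorm_zero : fourierStieltjesNorm (0 : Γ → ℂ) = 0 :=
  le_antisymm (sInf_le ⟨EllTwo Γ, inferInstance, inferInstance, inferInstance, leftRegular Γ, 0, 0,
    fun s => by simp, by simp⟩) bot_le

theorem mem_fourierAlgebra_of_memℓp {φ : Γ → ℂ} (hφ : Memℓp φ 2) : φ ∈ fourierAlgebra Γ := by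
  intro ε hε
  obtain ⟨g, hg⟩ := exists_coefficient_eq hφ
  refine ⟨φ, Submodule.subset_span ⟨delta 1, g, fun s => congrFun hg s⟩, ?_⟩
  rwa [sub_self, fourierStieltjesNorm_zero]

/-- Approximation in the Fourier–Stieltjes norm is stronger than in the Schur norm: a coefficient
with ‖ξ‖ ‖η‖ < δ has Schur norm at most δ. -/
theorem mem_finitelyApproximable_of_mem_fourierAlgebra {a : Γ → ℂ} (ha : a ∈ fourierAlgebra Γ) :
    a ∈ finitelyApproximable Γ := by
  refine mem_finitelyApproximable_of_forall fun δ hδ => ?_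
  obtain ⟨b, hb, hab⟩ := ha (ENNReal.ofReal δ) (by simpa using hδ)
  refine ⟨b, ?_, ?_⟩
  · refine Submodule.span_le.2 ?_ hb
    rintro c ⟨f, g, hc⟩
    have : c = coefficient f g := funext hc
    rw [this]
    exact coefficient_mem_finitelyApproximable f g
  · obtain ⟨_, ⟨H, _, _, _, π, ξ, η, hφ, rfl⟩, hlt⟩ := sInf_lt_iff.1 hab
    have h := isSchurBounded_coefficient π ξ η
    rw [← funext hφ] at h
    refine h.mono ?_
    rw [← ofReal_norm, ← ofReal_norm, ← ENNReal.ofReal_mul (norm_nonneg _)] at hlt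
    exact (ENNReal.ofReal_lt_ofReal_iff hδ).1 hlt |>.le

theorem exists_norm_le_of_finiteDimensional {E : Type*} [NormedAddCommGroup E] [NormedSpace ℂ E]
    (W : Submodule ℂ E) [FiniteDimensional ℂ W] (f : W →ₗ[ℂ] ℂ) :
    ∃ K : ℝ, 0 ≤ K ∧ ∀ w : W, ‖f w‖ ≤ K * ‖(w : E)‖ :=
  ⟨‖LinearMap.toContinuousLinearMap f‖, norm_nonneg (LinearMap.toContinuousLinearMap f),
    (LinearMap.toContinuousLinearMap f).le_opNorm⟩

/-- The symbol of a completely bounded finite rank map is approximable by finitely supported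
functions: it is square summable. -/
theorem symbolOf_mem_finitelyApproximable {V : Submodule ℂ (EllTwo Γ →L[ℂ] EllTwo Γ)}
    (hV : ∀ s, (leftRegular Γ s : EllTwo Γ →L[ℂ] EllTwo Γ) ∈ V) {T : V →ₗ[ℂ] V}
    (hfin : FiniteDimensional ℂ (LinearMap.range T)) {c : ℝ≥0} (hT : cbNorm T ≤ c) :
    symbolOf hV T ∈ finitelyApproximable Γ := by
  let W : Submodule ℂ (EllTwo Γ →L[ℂ] EllTwo Γ) := (LinearMap.range T).map V.subtype
  have hW : FiniteDimensional ℂ W := inferInstance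
  let b := Module.finBasis ℂ W
  let y : Γ → W := fun s => ⟨T ⟨leftRegular Γ s, hV s⟩, _, ⟨_, rfl⟩, rfl⟩
  have hy : ∀ s, ‖(y s : EllTwo Γ →L[ℂ] EllTwo Γ)‖ ≤ c := fun s => by
    have h := norm_map_le hT ⟨leftRegular Γ s, hV s⟩
    exact h.trans (mul_le_of_le_one_right c.2 (norm_leftRegular_le s))
  -- In a basis b of the range, the symbol is a finite sum of products of a coordinate of T(λ(s))
  -- with the function b k δ_1, which lies in ℓ²(Γ).
  have hsum : symbolOf hV T = ∑ k, fun s => b.repr (y s) k * (b k : EllTwo Γ →L[ℂ] EllTwo Γ)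
      (delta 1) s := by
    ext s
    have h1 := congrArg (fun w : W => (w : EllTwo Γ →L[ℂ] EllTwo Γ) (delta 1) s)
      (b.sum_repr (y s))
    refine h1.symm.trans ?_
    simp only [Submodule.coe_sum, Submodule.coe_smul, FunLike.coe_sum, Finset.sum_apply,
      lp.coeFn_sum, smul_apply, lp.coeFn_smul, Pi.smul_apply, smul_eq_mul]
  rw [hsum]
  refine sum_mem fun k _ => mem_finitelyApproximable_of_memℓp ?_
  obtain ⟨K, hK, hKb⟩ := exists_norm_le_of_finiteDimensional W (b.coord k)
  -- Coordinates are bounded on a finite-dimensional space and ‖T(λ(s))‖ ≤ c, so each summand is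
  -- dominated by a multiple of an ℓ² function.
  have hC : ∀ s, ‖b.repr (y s) k‖ ≤ K * c := fun s => (hKb (y s)).trans (by gcongr; exact hy s)
  have hmem := lp.memℓp ((((K * c : ℝ) : ℂ)) • (b k : EllTwo Γ →L[ℂ] EllTwo Γ) (delta 1))
  refine memℓp_gen (Summable.of_nonneg_of_le (fun s => by positivity) (fun s => ?_)
    (hmem.summable (by simp)))
  refine Real.rpow_le_rpow (norm_nonneg _) ?_ (by simp)
  rw [lp.coeFn_smul, Pi.smul_apply, norm_smul, norm_mul, Complex.norm_real, Real.norm_of_nonneg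
    (by positivity)]
  gcongr
  exact hC s

variable (Γ) in
/-- Approximation of `1` by finitely supported functions that are uniformly bounded as Schur
multipliers. -/
def HasSchurApproximation (c : ℝ≥0) : Prop :=
  ∀ (F : Finset Γ) (ε : ℝ), 0 < ε →
    ∃ φ : Γ →₀ ℂ, IsSchurBounded φ c ∧ ∀ s ∈ F, ‖φ s - 1‖ ≤ ε

/-- Truncation raises the Schur bound to c + ε/4. Scaling by c / (c + ε/4) restores c exactly and,
since values are bounded by the Schur norm, moves each of them by at most ε/4. -/
theorem hasSchurApproximation_of_forall {c : ℝ≥0} (hc : 1 ≤ c)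
    (h : ∀ (F : Finset Γ) (ε : ℝ), 0 < ε →
      ∃ a ∈ finitelyApproximable Γ, IsSchurBounded a c ∧ ∀ s ∈ F, ‖a s - 1‖ ≤ ε) :
    HasSchurApproximation Γ c := by
  intro F ε hε
  obtain ⟨a, ha, hac, haF⟩ := h F (ε / 2) (by positivity)
  obtain ⟨b, hb⟩ := ha (ε / 4) (by positivity)
  have hc' : (1 : ℝ) ≤ c := hc
  have hbc : IsSchurBounded b (c + ε / 4) := by
    have := hac.add (hb.smul (-1))
    simpa using this
  have hpos : (0 : ℝ) < c + ε / 4 := by positivity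
  let z : ℝ := c / (c + ε / 4)
  have hz0 : 0 ≤ z := by positivity
  have hz : z * (c + ε / 4) = c := div_mul_cancel₀ _ hpos.ne'
  refine ⟨(z : ℂ) • b, ?_, fun s hs => ?_⟩
  · have := hbc.smul (z : ℂ)
    rwa [Complex.norm_real, Real.norm_of_nonneg hz0, hz] at this
  · have h1 : ‖(1 - z : ℂ) * b s‖ ≤ ε / 4 := by
      rw [norm_mul, ← Complex.ofReal_one, ← Complex.ofReal_sub, Complex.norm_real,
        Real.norm_of_nonneg (sub_nonneg.2 (div_le_one_of_le₀ (by linarith) hpos.le))]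
      calc (1 - z) * ‖b s‖ ≤ (1 - z) * (c + ε / 4) := by
            gcongr
            · exact sub_nonneg.2 (div_le_one_of_le₀ (by linarith) hpos.le)
            · exact hbc.norm_apply_le s
        _ = ε / 4 := by rw [sub_mul, hz]; ring
    have h2 : ‖a s - b s‖ ≤ ε / 4 := hb.norm_apply_le s
    have e : ((z : ℂ) • b) s - 1 = (a s - 1) - (a s - b s) - (1 - z : ℂ) * b s := by
      simp only [Finsupp.smul_apply, smul_eq_mul]; ring
    rw [e]
    calc _ ≤ ‖a s - 1‖ + ‖a s - b s‖ + ‖(1 - z : ℂ) * b s‖ :=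
          (norm_sub_le _ _).trans (add_le_add_left (norm_sub_le _ _) _)
      _ ≤ ε / 2 + ε / 4 + ε / 4 := add_le_add (add_le_add (haF s hs) h2) h1
      _ = ε := by ring

end Approximable

universe u

/-! ### Multiplier maps of finitely supported functions -/

section MultiplierMap

variable {Γ : Type*} [Group Γ] {V : Submodule ℂ (EllTwo Γ →L[ℂ] EllTwo Γ)}

/-- The finite rank map `x ↦ ∑ s, φ(s) x(s) λ(s)`, where `x(s) = ⟨x δ_1, δ_s⟩`. -/
noncomputable def multiplierMap (hV : ∀ s, (leftRegular Γ s : EllTwo Γ →L[ℂ] EllTwo Γ) ∈ V)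
    (φ : Γ →₀ ℂ) : V →ₗ[ℂ] V where
  toFun x := ∑ s ∈ φ.support, (φ s * (x : EllTwo Γ →L[ℂ] EllTwo Γ) (delta 1) s) •
    (⟨leftRegular Γ s, hV s⟩ : V)
  map_add' x y := by
    rw [← Finset.sum_add_distrib]
    refine Finset.sum_congr rfl fun s _ => ?_
    rw [← add_smul, ← mul_add]
    rfl
  map_smul' c x := by
    rw [Finset.smul_sum]
    refine Finset.sum_congr rfl fun s _ => ?_
    rw [smul_smul, RingHom.id_apply, mul_left_comm]
    rfl

variable {hV : ∀ s, (leftRegular Γ s : EllTwo Γ →L[ℂ] EllTwo Γ) ∈ V}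

theorem coe_multiplierMap (φ : Γ →₀ ℂ) (x : V) :
    (multiplierMap hV φ x : EllTwo Γ →L[ℂ] EllTwo Γ) =
      ∑ s ∈ φ.support, (φ s * (x : EllTwo Γ →L[ℂ] EllTwo Γ) (delta 1) s) •
        (leftRegular Γ s : EllTwo Γ →L[ℂ] EllTwo Γ) := by
  simp [multiplierMap]

/-- In the defining sum only λ(t r⁻¹) has a nonzero entry at (t, r). Hence the map multiplies the
matrix of x entrywise by φ(t r⁻¹). -/
theorem multiplierMap_apply_delta (hconv : ∀ z ∈ V, IsConvolution z) (φ : Γ →₀ ℂ) (x : V)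
    (r t : Γ) : (multiplierMap hV φ x : EllTwo Γ →L[ℂ] EllTwo Γ) (delta r) t =
      φ (t * r⁻¹) * (x : EllTwo Γ →L[ℂ] EllTwo Γ) (delta r) t := by
  classical
  rw [hconv x x.2 r t, coe_multiplierMap]
  simp only [FunLike.coe_sum, Finset.sum_apply, lp.coeFn_sum, smul_apply, lp.coeFn_smul,
    Pi.smul_apply, smul_eq_mul, leftRegular_delta, delta_apply]
  rw [Finset.sum_eq_single (t * r⁻¹)]
  · simp
  · intro s _ hs
    have : t ≠ s * r := fun h => hs (by rw [h]; simp)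
    simp [this]
  · intro h
    simp [Finsupp.notMem_support_iff.1 h]

theorem multiplierMap_leftRegular (φ : Γ →₀ ℂ) (s : Γ) :
    multiplierMap hV φ ⟨leftRegular Γ s, hV s⟩ = φ s • (⟨leftRegular Γ s, hV s⟩ : V) := by
  classical
  refine Subtype.ext ?_
  rw [coe_multiplierMap, Finset.sum_eq_single s]
  · simp [leftRegular_delta, delta_apply]
  · intro t _ ht
    simp [leftRegular_delta, delta_apply, ht]
  · intro h
    simp [Finsupp.notMem_support_iff.1 h]

theorem finiteDimensional_range_multiplierMap (φ : Γ →₀ ℂ) :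
    FiniteDimensional ℂ (LinearMap.range (multiplierMap hV φ)) := by
  classical
  have : FiniteDimensional ℂ (Submodule.span ℂ
      ((fun s => (⟨leftRegular Γ s, hV s⟩ : V)) '' (φ.support : Set Γ))) :=
    FiniteDimensional.span_of_finite ℂ (φ.support.finite_toSet.image _)
  refine Submodule.finiteDimensional_of_le (S₂ := Submodule.span ℂ
      ((fun s => (⟨leftRegular Γ s, hV s⟩ : V)) '' (φ.support : Set Γ))) ?_
  rintro _ ⟨x, rfl⟩
  exact sum_mem fun s hs => Submodule.smul_mem _ _ (Submodule.subset_span ⟨s, hs, rfl⟩)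

/-- On every finite piece of the basis of ℓ²(Γ)ⁿ the amplified map is Schur multiplication by φ(t
r⁻¹), whatever the block indices. -/
theorem cbNorm_multiplierMap_le (hconv : ∀ z ∈ V, IsConvolution z) {φ : Γ →₀ ℂ} {c : ℝ≥0}
    (hφ : IsSchurBounded φ c) : cbNorm (multiplierMap hV φ) ≤ c := by
  refine iSup_le fun n => iSup_le fun x => iSup_le fun hx => enorm_le_coe_iff.2 ?_
  refine opNorm_le_of_formBound (deltaBasis Γ n) c.2 fun G => ?_
  have hX := formBound_of_orthonormal ((deltaBasis Γ n).orthonormal.comp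
    ((↑) : G → Fin n × Γ) Subtype.val_injective) hx
  -- The group labels repeat across blocks; since `IsSchurBounded` allows repetitions, one scalar
  -- condition controls all matrix levels.
  have h := hφ.formBound (fun p : G => p.1.2) hX
  convert h using 3 with p q
  refine (inner_deltaBasis_blockOp _ _ _).trans ?_
  rw [multiplierMap_apply_delta hconv]
  exact congrArg _ (inner_deltaBasis_blockOp (fun i j => (x i j : EllTwo Γ →L[ℂ] EllTwo Γ))
    p.1 q.1).symm

end MultiplierMap

/-! ### Weak⋆ convergence and continuity -/

section WeakStar

/-- A bounded net of operators on `ℓ²(Γ)` whose matrix coefficients converge to `0` converges to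
`0` in the weak⋆-topology. -/
theorem tendsto_pairing_zero {Γ ι : Type*} {l : Filter ι} {z : ι → EllTwo Γ →L[ℂ] EllTwo Γ}
    {c : ℝ} (hz : ∀ i, ‖z i‖ ≤ c) (h : ∀ r t, Tendsto (fun i => z i (delta r) t) l (𝓝 0))
    (y : TracePair (EllTwo Γ)) : Tendsto (fun i => y.pairing (z i)) l (𝓝 0) := by
  -- Boundedness and density extend convergence from basis vectors to arbitrary vectors, one side at
  -- a time; dominated convergence then handles the trace series.
  have h1 : ∀ t ξ, Tendsto (fun i => z i ξ t) l (𝓝 0) := by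
    intro t ξ
    refine tendsto_zero_of_dense_span (c := c)
      (fun i => ((innerSL ℂ (delta t)).comp (z i) : EllTwo Γ →L[ℂ] ℂ).toLinearMap) ?_
      dense_span_delta ?_ ξ |>.congr fun i => inner_delta_left _ _
    · intro i x
      calc _ = ‖z i x t‖ := by simp [inner_delta_left]
        _ ≤ ‖z i x‖ := norm_apply_le _ _
        _ ≤ c * ‖x‖ := (z i).le_of_opNorm_le (hz i) x
    · rintro _ ⟨r, rfl⟩
      exact (h r t).congr fun i => (inner_delta_left _ _).symm
  have h2 : ∀ ξ η, Tendsto (fun i => (inner ℂ η (z i ξ) : ℂ)) l (𝓝 0) := by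
    intro ξ η
    have := tendsto_zero_of_dense_span (c := c * ‖ξ‖)
      (fun i => (innerSL ℂ (z i ξ) : EllTwo Γ →L[ℂ] ℂ).toLinearMap) (l := l) ?_
      dense_span_delta ?_ η
    · rw [tendsto_zero_iff_norm_tendsto_zero] at this ⊢
      refine this.congr fun i => ?_
      exact norm_inner_symm (𝕜 := ℂ) (z i ξ) η
    · intro i x
      refine (norm_inner_le_norm (𝕜 := ℂ) (z i ξ) x).trans ?_
      gcongr
      exact (z i).le_of_opNorm_le (hz i) ξ
    · rintro _ ⟨t, rfl⟩
      rw [tendsto_zero_iff_norm_tendsto_zero]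
      refine (tendsto_zero_iff_norm_tendsto_zero.1 (h1 t ξ)).congr fun i => ?_
      rw [← inner_delta_left]
      exact norm_inner_symm (𝕜 := ℂ) (delta t) (z i ξ)
  have h3 := tendsto_tsum_of_dominated_convergence (𝓕 := l)
    (f := fun i n => (inner ℂ (y.η n) (z i (y.ξ n)) : ℂ)) (g := fun _ => 0)
    (bound := fun n => c * (‖y.η n‖ ^ 2 + ‖y.ξ n‖ ^ 2))
    ((y.summable_η.add y.summable_ξ).mul_left c) (fun n => h2 _ _)
    (Eventually.of_forall fun i n => ?_)
  · simpa [TracePair.pairing] using h3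
  · have hc : 0 ≤ c := (norm_nonneg _).trans (hz i)
    refine (norm_inner_apply_le (hz i) _ _).trans (mul_le_mul_of_nonneg_left ?_ hc)
    nlinarith [sq_nonneg (‖y.η n‖ - ‖y.ξ n‖), sq_nonneg ‖y.η n‖, sq_nonneg ‖y.ξ n‖]

theorem TracePair.pairing_add {H : Type*} [NormedAddCommGroup H] [InnerProductSpace ℂ H]
    (y : TracePair H) (x x' : H →L[ℂ] H) : y.pairing (x + x') = y.pairing x + y.pairing x' := by
  simp only [TracePair.pairing, add_apply, inner_add_right]
  exact (y.summable_norm x).of_norm.tsum_add (y.summable_norm x').of_norm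

theorem TracePair.pairing_smul {H : Type*} [NormedAddCommGroup H] [InnerProductSpace ℂ H]
    (y : TracePair H) (c : ℂ) (x : H →L[ℂ] H) : y.pairing (c • x) = c * y.pairing x := by
  simp only [TracePair.pairing, smul_apply, inner_smul_right, tsum_mul_left]

/-- The trace pairing as a linear functional. -/
noncomputable def TracePair.pairingLinear {H : Type*} [NormedAddCommGroup H]
    [InnerProductSpace ℂ H] (y : TracePair H) : (H →L[ℂ] H) →ₗ[ℂ] ℂ where
  toFun := y.pairing
  map_add' := y.pairing_add
  map_smul' := y.pairing_smul

/-- The rank one operator `⟨·, η⟩ ξ`. -/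
noncomputable def TracePair.rankOne {H : Type*} [NormedAddCommGroup H] [InnerProductSpace ℂ H]
    (ξ η : H) : TracePair H where
  ξ := Pi.single 0 ξ
  η := Pi.single 0 η
  summable_ξ := summable_of_ne_finset_zero (s := {0}) fun n hn => by
    simp [Pi.single_eq_of_ne (by simpa using hn : n ≠ 0)]
  summable_η := summable_of_ne_finset_zero (s := {0}) fun n hn => by
    simp [Pi.single_eq_of_ne (by simpa using hn : n ≠ 0)]

theorem TracePair.pairing_rankOne {H : Type*} [NormedAddCommGroup H] [InnerProductSpace ℂ H]
    (ξ η : H) (x : H →L[ℂ] H) : (TracePair.rankOne ξ η).pairing x = inner ℂ η (x ξ) := by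
  rw [TracePair.pairing, tsum_eq_single 0]
  · simp [TracePair.rankOne]
  · intro n hn
    simp [TracePair.rankOne, hn]

/-- Paired with any y, the map becomes a finite combination of the functionals x ↦ ⟨x δ_1, δ_s⟩,
which are pairings with rank one operators. -/
theorem isWeakStarContinuous_multiplierMap {Γ : Type*} [Group Γ] (φ : Γ →₀ ℂ) :
    IsWeakStarContinuous (groupVonNeumannAlgebra Γ)
      (multiplierMap (leftRegular_mem_groupVonNeumannAlgebra Γ) φ) := by
  let := weakStarTopology (groupVonNeumannAlgebra Γ)
  have hpair : ∀ y : TracePair (EllTwo Γ), Continuous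
      fun x : toSubmodule (groupVonNeumannAlgebra Γ) =>
        y.pairing (x : EllTwo Γ →L[ℂ] EllTwo Γ) := fun y =>
    continuous_iff_le_induced.2 (iInf_le _ y)
  refine continuous_iInf_rng.2 fun y => continuous_induced_rng.2 ?_
  have hy : ∀ x : toSubmodule (groupVonNeumannAlgebra Γ),
      y.pairing (multiplierMap (leftRegular_mem_groupVonNeumannAlgebra Γ) φ x :
        EllTwo Γ →L[ℂ] EllTwo Γ) =
      ∑ s ∈ φ.support, (φ s * (TracePair.rankOne (delta 1) (delta s)).pairing
        (x : EllTwo Γ →L[ℂ] EllTwo Γ)) * y.pairing (leftRegular Γ s) := by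
    intro x
    rw [coe_multiplierMap]
    refine (map_sum y.pairingLinear _ _).trans (Finset.sum_congr rfl fun s _ => ?_)
    rw [TracePair.pairing_rankOne, inner_delta_left]
    exact y.pairing_smul _ _
  exact (continuous_finsetSum _ fun s _ =>
    ((hpair _).const_mul (φ s)).mul_const _).congr fun x => (hy x).symm

end WeakStar

/-! ### The equivalences for a given constant -/

section Equivalences

variable {Γ : Type u} [Group Γ]

theorem HasSchurApproximation.exists_net {c : ℝ≥0} (h : HasSchurApproximation Γ c) :
    ∃ (ι : Type u) (_ : Preorder ι) (_ : IsDirectedOrder ι) (_ : Nonempty ι) (φ : ι → Γ →₀ ℂ),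
      (∀ i, IsSchurBounded (φ i) c) ∧ ∀ s, Tendsto (fun i => φ i s) atTop (𝓝 1) := by
  classical
  -- The net is indexed by a finite set together with an accuracy 1/(n + 1).
  choose φ hφ hφF using fun p : Finset Γ × ℕ => h p.1 (1 / (p.2 + 1)) Nat.one_div_pos_of_nat
  refine ⟨Finset Γ × ℕ, inferInstance, inferInstance, inferInstance, φ, hφ, fun s => ?_⟩
  rw [Metric.tendsto_atTop]
  intro ε hε
  obtain ⟨n, hn⟩ := exists_nat_one_div_lt hε
  refine ⟨({s}, n), fun p hp => ?_⟩
  rw [dist_eq_norm]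
  refine (hφF p s (hp.1 (by simp))).trans_lt (lt_of_le_of_lt ?_ hn)
  exact Nat.one_div_le_one_div hp.2

theorem isWeaklyAmenableWith_iff {c : ℝ≥0} (hc : 1 ≤ c) :
    IsWeaklyAmenableWith Γ c ↔ HasSchurApproximation Γ c := by
  constructor
  · rintro ⟨ι, _, _, _, a, ha, hac, hlim⟩
    refine hasSchurApproximation_of_forall hc fun F ε hε => ?_
    obtain ⟨i, hi⟩ := (Metric.tendstoUniformlyOn_iff.1 (hlim F F.finite_toSet) ε hε).exists
    refine ⟨a i, mem_finitelyApproximable_of_mem_fourierAlgebra (ha i), ?_, fun s hs => ?_⟩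
    -- The infimum defining the multiplier norm may not be attained, so a map is chosen for each d >
    -- c.
    · refine IsSchurBounded.of_forall_lt fun d hd => ?_
      have hd0 : (0 : ℝ) ≤ d := c.2.trans hd.le
      lift d to ℝ≥0 using hd0
      have hlt : cbMultiplierNorm (a i) < d :=
        (hac i).trans_lt (ENNReal.coe_lt_coe.2 (NNReal.coe_lt_coe.1 hd))
      simp only [cbMultiplierNorm, iInf_lt_iff] at hlt
      obtain ⟨_, M, hM, hMd⟩ := hlt
      have h := isSchurBounded_symbolOf (leftRegular_mem_groupVonNeumannAlgebra Γ)
        (fun _ => isConvolution_of_mem_groupVonNeumannAlgebra) hMd.le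
      convert h using 1
      ext s
      have hs : M ⟨leftRegular Γ s, leftRegular_mem_groupVonNeumannAlgebra Γ s⟩ = _ := hM.2 s
      rw [symbolOf, hs]
      simp [leftRegularVN, leftRegular_delta, delta_apply]
    · have := (hi s hs).le
      rwa [dist_comm, dist_eq_norm] at this
  · intro h
    obtain ⟨ι, _, _, _, φ, hφ, hlim⟩ := h.exists_net
    have hmem : ∀ b : Γ →₀ ℂ, ⇑b ∈ fourierAlgebra Γ := fun b =>
      mem_fourierAlgebra_of_memℓp (memℓp_gen (summable_of_ne_finset_zero (s := b.support)
        fun s hs => by simp [Finsupp.notMem_support_iff.1 hs]))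
    refine ⟨ι, inferInstance, inferInstance, inferInstance, fun i => φ i, fun i => hmem _,
      fun i => ?_, fun K hK => ?_⟩
    -- The product of φ i with any function is finitely supported, hence in A(Γ).
    · have hmul : IsMultiplier (φ i) := fun a _ => by
        have := hmem (Finsupp.onFinset (φ i).support (φ i * a) fun s hs => by
          rw [Finsupp.mem_support_iff]; exact left_ne_zero_of_mul hs)
        exact this
      have hmap : IsMultiplierMap (φ i)
          (multiplierMap (leftRegular_mem_groupVonNeumannAlgebra Γ) (φ i)) :=
        ⟨isWeakStarContinuous_multiplierMap (φ i), multiplierMap_leftRegular (φ i)⟩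
      exact (iInf_le_of_le hmul (iInf₂_le_of_le _ hmap le_rfl)).trans (cbNorm_multiplierMap_le
          (fun _ => isConvolution_of_mem_groupVonNeumannAlgebra) (hφ i))
    · rw [Metric.tendstoUniformlyOn_iff]
      intro ε hε
      refine (hK.eventually_all (p := fun s i => dist (1 : ℂ) (φ i s) < ε)).2 fun s _ => ?_
      filter_upwards [Metric.tendsto_nhds.1 (hlim s) ε hε] with i hi
      rwa [dist_comm]

/-- A bounded net of finite rank maps for which the symbols converge to `1` gives a Schur
approximation. -/
theorem hasSchurApproximation_of_net {V : Submodule ℂ (EllTwo Γ →L[ℂ] EllTwo Γ)}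
    (hV : ∀ s, (leftRegular Γ s : EllTwo Γ →L[ℂ] EllTwo Γ) ∈ V)
    (hconv : ∀ z ∈ V, IsConvolution z) {c : ℝ≥0} (hc : 1 ≤ c) {ι : Type*} {l : Filter ι} [l.NeBot]
    {T : ι → V →ₗ[ℂ] V} (hfin : ∀ i, FiniteDimensional ℂ (LinearMap.range (T i)))
    (hT : ∀ i, cbNorm (T i) ≤ c) (hlim : ∀ s, Tendsto (fun i => symbolOf hV (T i) s) l (𝓝 1)) :
    HasSchurApproximation Γ c := by
  refine hasSchurApproximation_of_forall hc fun F ε hε => ?_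
  have hev : ∀ᶠ i in l, ∀ s ∈ F, dist (symbolOf hV (T i) s) 1 < ε :=
    (Finset.eventually_all F).2 fun s _ => Metric.tendsto_nhds.1 (hlim s) ε hε
  obtain ⟨i, hi⟩ := hev.exists
  refine ⟨_, symbolOf_mem_finitelyApproximable hV (hfin i) (hT i),
    isSchurBounded_symbolOf hV hconv (hT i), fun s hs => ?_⟩
  rw [← dist_eq_norm]
  exact (hi s hs).le

theorem exists_mem_span_leftRegular (x : (reducedGroupCStarAlgebra Γ).toSubmodule) (ε : ℝ)
    (hε : 0 < ε) : ∃ y ∈ Submodule.span ℂ (Set.range fun s : Γ =>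
      (⟨leftRegular Γ s, leftRegular_mem_reducedGroupCStarAlgebra s⟩ :
        (reducedGroupCStarAlgebra Γ).toSubmodule)),
      ‖((x - y : (reducedGroupCStarAlgebra Γ).toSubmodule) : EllTwo Γ →L[ℂ] EllTwo Γ)‖ < ε := by
  have hx : (x : EllTwo Γ →L[ℂ] EllTwo Γ) ∈
      closure (groupAlgebraImage Γ : Set (EllTwo Γ →L[ℂ] EllTwo Γ)) := x.2
  obtain ⟨_, ⟨f, rfl⟩, hf⟩ := Metric.mem_closure_iff.1 hx ε hε
  have hspan : ∀ f : MonoidAlgebra ℂ Γ, leftRegularAlg Γ f ∈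
      (Submodule.span ℂ (Set.range fun s : Γ =>
        (⟨leftRegular Γ s, leftRegular_mem_reducedGroupCStarAlgebra s⟩ :
          (reducedGroupCStarAlgebra Γ).toSubmodule))).map
        (reducedGroupCStarAlgebra Γ).toSubmodule.subtype := by
    intro f
    induction f using MonoidAlgebra.induction_linear with
    | zero => rw [map_zero]; exact zero_mem _
    | add f g hf hg => rw [map_add]; exact add_mem hf hg
    | single s z =>
      rw [leftRegularAlg_single]
      exact Submodule.smul_mem _ z ⟨_, Submodule.subset_span ⟨s, rfl⟩, rfl⟩
  obtain ⟨y, hy, hyf⟩ := hspan f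
  refine ⟨y, hy, ?_⟩
  have h := (congrArg (dist (x : EllTwo Γ →L[ℂ] EllTwo Γ)) hyf).trans_lt hf
  rwa [dist_eq_norm] at h

/-- One way, |φ_T(s) - 1| ≤ ‖T λ(s) - λ(s)‖. The other way, the multiplier maps are bounded by c and
converge on each λ(s), whose span is norm dense. -/
theorem hasCBAPWith_iff {c : ℝ≥0} (hc : 1 ≤ c) :
    HasCBAPWith (reducedGroupCStarAlgebra Γ) c ↔ HasSchurApproximation Γ c := by
  have hV := leftRegular_mem_reducedGroupCStarAlgebra (Γ := Γ)
  have hconv : ∀ z ∈ (reducedGroupCStarAlgebra Γ).toSubmodule, IsConvolution z :=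
    fun _ => isConvolution_of_mem_reducedGroupCStarAlgebra
  constructor
  · rintro ⟨ι, _, _, _, T, hfin, hT, hlim⟩
    refine hasSchurApproximation_of_net hV hconv hc (l := atTop) hfin hT fun s => ?_
    rw [tendsto_iff_norm_sub_tendsto_zero]
    refine squeeze_zero (fun _ => norm_nonneg _) (fun i => ?_) (hlim ⟨leftRegular Γ s, hV s⟩)
    let d : EllTwo Γ →L[ℂ] EllTwo Γ := T i ⟨leftRegular Γ s, hV s⟩ - leftRegular Γ s
    calc ‖symbolOf hV (T i) s - 1‖ = ‖d (delta 1) s‖ := by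
          simp [d, symbolOf, leftRegular_delta, delta_apply]
      _ ≤ ‖d (delta 1)‖ := norm_apply_le _ _
      _ ≤ ‖d‖ * ‖(delta 1 : EllTwo Γ)‖ := d.le_opNorm _
      _ = ‖d‖ := by rw [norm_delta, mul_one]
      _ = _ := rfl
  · intro h
    obtain ⟨ι, _, _, _, φ, hφ, hlim⟩ := h.exists_net
    have hcb : ∀ i, cbNorm (multiplierMap hV (φ i)) ≤ c := fun i =>
      cbNorm_multiplierMap_le hconv (hφ i)
    refine ⟨ι, inferInstance, inferInstance, inferInstance, fun i => multiplierMap hV (φ i),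
      fun i => finiteDimensional_range_multiplierMap _, hcb, fun x => ?_⟩
    have h0 := tendsto_zero_of_forall_exists_span (l := atTop) (c := c + 1)
      (fun i => (reducedGroupCStarAlgebra Γ).toSubmodule.subtype ∘ₗ
        (multiplierMap hV (φ i) - LinearMap.id))
      (p := fun x : (reducedGroupCStarAlgebra Γ).toSubmodule => ‖(x : EllTwo Γ →L[ℂ] EllTwo Γ)‖)
      (fun _ => norm_nonneg _) (fun i x => ?_)
      exists_mem_span_leftRegular ?_ x
    · have h1 := tendsto_zero_iff_norm_tendsto_zero.1 h0
      exact h1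
    · have h1 : ‖(multiplierMap hV (φ i) x : EllTwo Γ →L[ℂ] EllTwo Γ) - x‖ ≤
          (c + 1) * ‖(x : EllTwo Γ →L[ℂ] EllTwo Γ)‖ := by
        refine (norm_sub_le _ _).trans ?_
        rw [add_mul, one_mul]
        exact add_le_add_left (norm_map_le (hcb i) x) _
      exact h1
    · rintro _ ⟨s, rfl⟩
      have := ((hlim s).sub_const 1).smul_const (leftRegular Γ s : EllTwo Γ →L[ℂ] EllTwo Γ)
      rw [sub_self, zero_smul] at this
      refine this.congr fun i => ?_
      rw [LinearMap.comp_apply, LinearMap.sub_apply, multiplierMap_leftRegular, sub_smul, one_smul]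
      rfl

theorem hasWStarCBAPWith_iff {c : ℝ≥0} (hc : 1 ≤ c) :
    HasWStarCBAPWith (groupVonNeumannAlgebra Γ) c ↔ HasSchurApproximation Γ c := by
  have hV := leftRegular_mem_groupVonNeumannAlgebra Γ
  have hconv : ∀ z ∈ toSubmodule (groupVonNeumannAlgebra Γ), IsConvolution z :=
    fun _ => isConvolution_of_mem_groupVonNeumannAlgebra
  constructor
  · rintro ⟨ι, _, _, _, T, hfin, -, hT, hlim⟩
    refine hasSchurApproximation_of_net hV hconv hc (l := atTop) hfin hT fun s => ?_
    -- Pairing with this rank one operator evaluates the symbol at s.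
    have h := hlim ⟨leftRegular Γ s, hV s⟩ (TracePair.rankOne (delta 1) (delta s))
    simp only [TracePair.pairing_rankOne, inner_delta_left, leftRegular_delta] at h
    simpa [delta_apply, symbolOf] using h
  · intro h
    obtain ⟨ι, _, _, _, φ, hφ, hlim⟩ := h.exists_net
    have hcb : ∀ i, cbNorm (multiplierMap hV (φ i)) ≤ c := fun i =>
      cbNorm_multiplierMap_le hconv (hφ i)
    refine ⟨ι, inferInstance, inferInstance, inferInstance, fun i => multiplierMap hV (φ i),
      fun i => finiteDimensional_range_multiplierMap _,
      fun i => isWeakStarContinuous_multiplierMap _, hcb, fun x y => ?_⟩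
    -- The matrix coefficients of the difference are (φ_i(t r⁻¹) - 1) times those of x. As the span
    -- of the λ(s) need not be norm dense in LΓ, this replaces the density argument.
    have h0 := tendsto_pairing_zero (l := atTop)
      (z := fun i => (multiplierMap hV (φ i) x : EllTwo Γ →L[ℂ] EllTwo Γ) +
        (-1 : ℂ) • (x : EllTwo Γ →L[ℂ] EllTwo Γ))
      (c := c * ‖(x : EllTwo Γ →L[ℂ] EllTwo Γ)‖ + ‖(x : EllTwo Γ →L[ℂ] EllTwo Γ)‖)
      (fun i => (norm_add_le _ _).trans (add_le_add (norm_map_le (hcb i) x)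
        (by rw [norm_smul]; simp))) (fun r t => ?_) y
    · rw [← tendsto_sub_nhds_zero_iff]
      refine h0.congr fun i => ?_
      rw [y.pairing_add, y.pairing_smul]
      ring
    · have := ((hlim (t * r⁻¹)).sub_const 1).mul_const
        ((x : EllTwo Γ →L[ℂ] EllTwo Γ) (delta r) t)
      rw [sub_self, zero_mul] at this
      refine this.congr fun i => ?_
      simp only [add_apply, smul_apply, lp.coeFn_add, lp.coeFn_smul, Pi.add_apply, Pi.smul_apply,
        multiplierMap_apply_delta hconv, smul_eq_mul]
      ring

end Equivalences

end CowlingHaagerup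

/-! ### The theorem, from the equivalences at each constant -/

theorem mainTheorem1 (Γ : Type*) [Group Γ] :
    [CowlingHaagerup.IsWeaklyAmenable Γ,
      CowlingHaagerup.HasCBAP (CowlingHaagerup.reducedGroupCStarAlgebra Γ),
      CowlingHaagerup.HasWStarCBAP (CowlingHaagerup.groupVonNeumannAlgebra Γ)].TFAE ∧
    CowlingHaagerup.cowlingHaagerupConstant Γ =
      CowlingHaagerup.cbapConstant (CowlingHaagerup.reducedGroupCStarAlgebra Γ) ∧
    CowlingHaagerup.cbapConstant (CowlingHaagerup.reducedGroupCStarAlgebra Γ) =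
      CowlingHaagerup.wStarCBAPConstant (CowlingHaagerup.groupVonNeumannAlgebra Γ) := by
  have h12 : ∀ c : NNReal, 1 ≤ c → (CowlingHaagerup.IsWeaklyAmenableWith Γ c ↔
      CowlingHaagerup.HasCBAPWith (CowlingHaagerup.reducedGroupCStarAlgebra Γ) c) := fun c hc =>
    (CowlingHaagerup.isWeaklyAmenableWith_iff hc).trans (CowlingHaagerup.hasCBAPWith_iff hc).symm
  have h23 : ∀ c : NNReal, 1 ≤ c →
      (CowlingHaagerup.HasCBAPWith (CowlingHaagerup.reducedGroupCStarAlgebra Γ) c ↔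
        CowlingHaagerup.HasWStarCBAPWith (CowlingHaagerup.groupVonNeumannAlgebra Γ) c) :=
    fun c hc =>
      (CowlingHaagerup.hasCBAPWith_iff hc).trans (CowlingHaagerup.hasWStarCBAPWith_iff hc).symm
  refine ⟨?_, ?_, ?_⟩
  · tfae_have 1 ↔ 2 := exists_congr fun c => and_congr_right fun hc => h12 c hc
    tfae_have 2 ↔ 3 := exists_congr fun c => and_congr_right fun hc => h23 c hc
    tfae_finish
  · exact iInf_congr fun c => iInf_congr fun hc => iInf_congr_Prop (h12 c hc) fun _ => rfl
  · exact iInf_congr fun c => iInf_congr fun hc => iInf_congr_Prop (h23 c hc) fun _ => rfl
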